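/- Let $D$ be a UHF algebra, that is, a unital $C^*$-algebra with an increasing sequence of subalgebras $A_0\subseteq A_1\subseteq\cdots$, each containing $1_D$, with $A_j\cong M_{k_j}(\mathbb C)$, $k_j\ge 1$, and with dense union. Its supernatural number is $\prod_q q^{e_q}$, the product being over all primes $q$, with $e_q=\sup_j v_q(k_j)\in\{0,1,2,\dots,\infty\}$, where $v_q$ is the $q$-adic valuation. Suppose that $D$ is of infinite type (equivalently, $D\cong\mathbb C$ or $D$ is strongly self-absorbing), that is, $e_q\in\{0,\infty\}$ for every prime $q$, and let $p$ be a prime that appears in its supernatural number, that is, $e_p\neq 0$. Let $n\ge 1$ and let the symmetric group $S_n$ act on the $C^*$-tensor power $D^{\otimes n}$ by permutation of the factors, $\alpha_g(a_1\otimes\cdots\otimes a_n)=a_{g(1)}\otimes\cdots\otimes a_{g(n)}$. Then there is a unital embedding (an injective unital $*$-homomorphism) of the UHF algebra $M_{p^\infty}=\varinjlim M_{p^j}(\mathbb C)$ into the fixed point subalgebra $(D^{\otimes n})^{S_n}=\{x\in D^{\otimes n}:\alpha_g(x)=x\text{ for all }g\in S_n\}$. -/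

import Mathlib

noncomputable section

namespace CStarTensor

open PiTensorProduct

/-- The algebraic tensor power `D ⊙ ⋯ ⊙ D` (`n` factors) over `ℂ`. -/
def AlgPower (D : Type*) [CStarAlgebra D] (n : ℕ) : Type _ :=
  PiTensorProduct ℂ (fun _ : Fin n => D)

/-- A C⋆-seminorm on a unital `⋆`-algebra over `ℂ`. -/
structure IsCStarSeminorm {A : Type*} [Ring A] [StarRing A] [Algebra ℂ A] (q : A → ℝ) : Prop where
  nonneg : ∀ x, 0 ≤ q x
  add_le : ∀ x y, q (x + y) ≤ q x + q y
  smul : ∀ (c : ℂ) x, q (c • x) = ‖c‖ * q x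
  mul_le : ∀ x y, q (x * y) ≤ q x * q y
  star_mul_self : ∀ x, q (star x * x) = q x ^ 2

namespace AlgPower

variable {D : Type*} [CStarAlgebra D] {n : ℕ}

instance : Ring (AlgPower D n) :=
  inferInstanceAs (Ring (PiTensorProduct ℂ (fun _ : Fin n => D)))

instance : Algebra ℂ (AlgPower D n) :=
  inferInstanceAs (Algebra ℂ (PiTensorProduct ℂ (fun _ : Fin n => D)))

/-- The elementary tensor `a₀ ⊗ ⋯ ⊗ aₙ₋₁`. -/
def tmul : MultilinearMap ℂ (fun _ : Fin n => D) (AlgPower D n) :=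
  PiTensorProduct.tprod ℂ

lemma one_eq : (1 : AlgPower D n) = tmul 1 := rfl

lemma tmul_mul_tmul (a b : Fin n → D) :
    (tmul a * tmul b : AlgPower D n) = tmul (a * b) :=
  (map_mul (PiTensorProduct.tprodMonoidHom ℂ) a b).symm

lemma induction {P : AlgPower D n → Prop} (h : ∀ (c : ℂ) (a : Fin n → D), P (c • tmul a))
    (hadd : ∀ x y, P x → P y → P (x + y)) (x : AlgPower D n) : P x :=
  PiTensorProduct.induction_on x h hadd

/-- The involution as an additive map, `c • (a₀ ⊗ ⋯ ⊗ aₙ₋₁) ↦ c̄ • (a₀⋆ ⊗ ⋯ ⊗ aₙ₋₁⋆)`. -/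
def starAdd : AlgPower D n →+ AlgPower D n :=
  PiTensorProduct.liftAddHom
    (fun r : ℂ × (Fin n → D) => star r.1 • tmul (fun i => star (r.2 i)))
    (fun r f i hf => by
      have : tmul (fun i => star (f i)) = (0 : AlgPower D n) :=
        tmul.map_coord_zero i (by simp [hf])
      simp [this])
    (fun f => by simp)
    (fun {_} r f i a b => by
      have e (c : D) : (fun j => star (Function.update f i c j))
          = Function.update (fun j => star (f j)) i (star c) := by
        funext j; by_cases h : j = i
        · subst h; simp
        · simp [h]
      simp only [e, star_add, ← smul_add]
      rw [← MultilinearMap.map_update_add])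
    (fun r s f => by simp [add_smul])
    (fun {_} r f i s => by
      have e (c : D) : (fun j => star (Function.update f i c j))
          = Function.update (fun j => star (f j)) i (star c) := by
        funext j; by_cases h : j = i
        · subst h; simp
        · simp [h]
      simp only [e, star_smul]
      rw [MultilinearMap.map_update_smul, smul_smul]
      simp [mul_comm])

lemma starAdd_smul_tmul (c : ℂ) (a : Fin n → D) :
    starAdd (c • tmul a : AlgPower D n) = star c • tmul (fun i => star (a i)) := by
  have h : (c • tmul a : AlgPower D n) = PiTensorProduct.tprodCoeff ℂ c a :=
    (PiTensorProduct.tprodCoeff_eq_smul_tprod c a).symm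
  rw [h]
  rfl

instance : StarRing (AlgPower D n) where
  star := starAdd
  star_involutive x := by
    induction x using induction with
    | h c a => simp [starAdd_smul_tmul]
    | hadd x y hx hy => rw [map_add, map_add, hx, hy]
  star_mul x y := by
    change starAdd (x * y) = starAdd y * starAdd x
    induction x using induction with
    | h c a =>
      induction y using induction with
      | h d b =>
        rw [smul_mul_smul_comm, tmul_mul_tmul, starAdd_smul_tmul, starAdd_smul_tmul,
          starAdd_smul_tmul, smul_mul_smul_comm, tmul_mul_tmul, star_mul]
        congr 2
        funext i
        simp
      | hadd y z hy hz => rw [mul_add, map_add, map_add, hy, hz, add_mul]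
    | hadd x z hx hz => rw [add_mul, map_add, map_add, hx, hz, mul_add]
  star_add := map_add starAdd

lemma star_smul_tmul (c : ℂ) (a : Fin n → D) :
    star (c • tmul a : AlgPower D n) = star c • tmul (fun i => star (a i)) :=
  starAdd_smul_tmul c a

lemma star_tmul (a : Fin n → D) :
    star (tmul a : AlgPower D n) = tmul (fun i => star (a i)) := by
  simpa using star_smul_tmul 1 a

instance : StarModule ℂ (AlgPower D n) where
  star_smul c x := by
    induction x using induction with
    | h d a => rw [smul_smul, star_smul_tmul, star_smul_tmul, smul_smul, star_mul, mul_comm]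
    | hadd x y hx hy => rw [smul_add, star_add, hx, hy, star_add, smul_add]

end AlgPower

namespace IsCStarSeminorm

section
variable {A : Type*} [Ring A] [StarRing A] [Algebra ℂ A] {q : A → ℝ}

lemma zero : IsCStarSeminorm (fun _ : A => (0 : ℝ)) where
  nonneg := by simp
  add_le := by simp
  smul := by simp
  mul_le := by simp
  star_mul_self := by simp

lemma map_one_le (hq : IsCStarSeminorm q) : q 1 ≤ 1 := by
  have h := hq.star_mul_self 1
  simp only [star_one, mul_one] at h
  nlinarith [hq.nonneg 1]

lemma map_star (hq : IsCStarSeminorm q) (x : A) : q (star x) = q x := by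
  have key (y : A) : q y ≤ q (star y) := by
    have h := hq.star_mul_self y
    have h' := hq.mul_le (star y) y
    rcases (hq.nonneg y).eq_or_lt with h0 | h0
    · rw [← h0]; exact hq.nonneg _
    · nlinarith
  exact le_antisymm (by simpa using key (star x)) (key x)

lemma comp {B : Type*} [Ring B] [StarRing B] [Algebra ℂ B] (hq : IsCStarSeminorm q)
    (f : B →⋆ₐ[ℂ] A) : IsCStarSeminorm (fun b => q (f b)) where
  nonneg _ := hq.nonneg _
  add_le _ _ := by simpa using hq.add_le _ _
  smul _ _ := by simpa using hq.smul _ _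
  mul_le _ _ := by simpa using hq.mul_le _ _
  star_mul_self x := by
    have h := hq.star_mul_self (f x)
    rwa [← StarHomClass.map_star f, ← map_mul] at h
end

/-- A C⋆-seminorm on a C⋆-algebra is dominated by the norm. -/
lemma le_norm {A : Type*} [CStarAlgebra A] {q : A → ℝ} (hq : IsCStarSeminorm q) (x : A) :
    q x ≤ ‖x‖ := by
  let _ := CStarAlgebra.spectralOrder A
  let _ := CStarAlgebra.spectralOrderedRing A
  have hu (u : A) (hu : u ∈ unitary A) : q u ≤ 1 := by
    have h := hq.star_mul_self u
    rw [(Unitary.mem_iff.1 hu).1] at h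
    nlinarith [hq.nonneg u, hq.map_one_le]
  have h1 (h : selfAdjoint A) (hn : ‖(h : A)‖ ≤ 1) : q (h : A) ≤ 1 := by
    set u := selfAdjoint.unitarySelfAddISMul h hn with hu'
    have e : (h : A) = (2⁻¹ : ℂ) • ((u : A) + star (u : A)) := by
      have e1 := selfAdjoint.star_coe_unitarySelfAddISMul h hn
      have e2 : (selfAdjoint.unitarySelfAddISMul h hn : A)
          = h + Complex.I • CFC.sqrt (1 - (h : A) ^ 2) := rfl
      rw [← hu'] at e1 e2
      rw [e1, e2]
      module
    rw [e, hq.smul]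
    have := hq.add_le (u : A) (star (u : A))
    rw [hq.map_star] at this
    have := hu u u.2
    norm_num
    linarith
  have h2 (h : A) (hs : IsSelfAdjoint h) : q h ≤ ‖h‖ := by
    rcases eq_or_ne h 0 with rfl | h0
    · have := hq.smul 0 0
      simp at this
      simp [this]
    · have hpos : 0 < ‖h‖ := norm_pos_iff.2 h0
      have hs' : IsSelfAdjoint (((‖h‖⁻¹ : ℝ) : ℂ) • h) := by
        refine IsSelfAdjoint.smul ?_ hs
        simp [isSelfAdjoint_iff]
      have := h1 ⟨_, hs'⟩ (by simp [norm_smul, hpos.ne'])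
      simp only [hq.smul] at this
      rw [Complex.norm_real, norm_inv, norm_norm, inv_mul_le_one₀ hpos] at this
      exact this
  have h3 := h2 (star x * x) (.star_mul_self x)
  rw [hq.star_mul_self, CStarRing.norm_star_mul_self, ← sq] at h3
  exact (sq_le_sq₀ (hq.nonneg x) (norm_nonneg x)).1 h3

end IsCStarSeminorm

namespace AlgPower

variable {D : Type*} [CStarAlgebra D] {n : ℕ}

/-- `a ↦ 1 ⊗ ⋯ ⊗ a ⊗ ⋯ ⊗ 1`, with `a` in position `i`. -/
def single (i : Fin n) : D →⋆ₐ[ℂ] AlgPower D n where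
  toAlgHom := (PiTensorProduct.singleAlgHom (R := ℂ) (A := fun _ : Fin n => D) i :)
  map_star' a := by
    change (tmul (Pi.mulSingle i (star a)) : AlgPower D n) = star (tmul (Pi.mulSingle i a))
    rw [star_tmul]
    congr 1
    funext j
    by_cases h : j = i
    · subst h; simp
    · simp [h]

lemma exists_bound (x : AlgPower D n) :
    ∃ C, ∀ q : AlgPower D n → ℝ, IsCStarSeminorm q → q x ≤ C := by
  induction x using induction with
  | h c a =>
    refine ⟨‖c‖ * ∏ i, (‖a i‖), fun q hq => ?_⟩
    rw [hq.smul]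
    refine mul_le_mul_of_nonneg_left ?_ (norm_nonneg _)
    have key : ∀ s : Finset (Fin n),
        q (tmul (fun i => if i ∈ s then a i else 1)) ≤ ∏ i ∈ s, ‖a i‖ := by
      intro s
      induction s using Finset.induction_on with
      | empty => simpa using! hq.map_one_le
      | insert j s hj ih =>
        have e : (tmul (fun i => if i ∈ insert j s then a i else 1) : AlgPower D n)
            = single j (a j) * tmul (fun i => if i ∈ s then a i else 1) := by
          change _ = tmul (Pi.mulSingle j (a j)) * _
          rw [tmul_mul_tmul]
          congr 1
          funext i
          by_cases h : i = j
          · subst h; simp [hj]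
          · simp [h]
        rw [e, Finset.prod_insert hj]
        refine (hq.mul_le _ _).trans ?_
        exact mul_le_mul ((hq.comp (single j)).le_norm (a j)) ih (hq.nonneg _) (norm_nonneg _)
    simpa using key Finset.univ
  | hadd x y hx hy =>
    obtain ⟨C, hC⟩ := hx
    obtain ⟨C', hC'⟩ := hy
    exact ⟨C + C', fun q hq => (hq.add_le x y).trans (add_le_add (hC q hq) (hC' q hq))⟩

/-- The maximal C⋆-norm on the algebraic tensor power: the supremum of all C⋆-seminorms
(finite by `exists_bound`). If `D` is nuclear, for instance UHF, it is the only C⋆-norm. -/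
def maxNorm (x : AlgPower D n) : ℝ :=
  ⨆ q : {q : AlgPower D n → ℝ // IsCStarSeminorm q}, q.1 x

instance : Nonempty {q : AlgPower D n → ℝ // IsCStarSeminorm q} := ⟨⟨_, .zero⟩⟩

lemma le_maxNorm {q : AlgPower D n → ℝ} (hq : IsCStarSeminorm q) (x : AlgPower D n) :
    q x ≤ maxNorm x := by
  obtain ⟨C, hC⟩ := exists_bound x
  exact le_ciSup (f := fun q : {q : AlgPower D n → ℝ // IsCStarSeminorm q} => q.1 x)
    ⟨C, by rintro _ ⟨q, rfl⟩; exact hC _ q.2⟩ ⟨q, hq⟩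

lemma maxNorm_le {x : AlgPower D n} {C : ℝ}
    (h : ∀ q : AlgPower D n → ℝ, IsCStarSeminorm q → q x ≤ C) : maxNorm x ≤ C :=
  ciSup_le fun q => h _ q.2

lemma maxNorm_isCStarSeminorm : IsCStarSeminorm (maxNorm : AlgPower D n → ℝ) := by
  have h0 (x : AlgPower D n) : 0 ≤ maxNorm x := le_maxNorm .zero x
  have hle (c : ℂ) (x : AlgPower D n) : maxNorm (c • x) ≤ ‖c‖ * maxNorm x :=
    maxNorm_le fun q hq => by
      rw [hq.smul]; exact mul_le_mul_of_nonneg_left (le_maxNorm hq x) (norm_nonneg _)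
  refine ⟨h0, fun x y => maxNorm_le fun q hq => (hq.add_le x y).trans
    (add_le_add (le_maxNorm hq x) (le_maxNorm hq y)), fun c x => le_antisymm (hle c x) ?_,
    fun x y => maxNorm_le fun q hq => (hq.mul_le x y).trans
      (mul_le_mul (le_maxNorm hq x) (le_maxNorm hq y) (hq.nonneg _) (h0 _)),
    fun x => le_antisymm (maxNorm_le fun q hq => ?_) ?_⟩
  · rcases eq_or_ne c 0 with rfl | hc
    · simpa using h0 _
    · have := hle c⁻¹ (c • x)
      rw [inv_smul_smul₀ hc, norm_inv] at this
      rwa [le_inv_mul_iff₀ (norm_pos_iff.2 hc)] at this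
  · rw [hq.star_mul_self]
    exact pow_le_pow_left₀ (hq.nonneg x) (le_maxNorm hq x) 2
  · have : maxNorm x ≤ √(maxNorm (star x * x)) := maxNorm_le fun q hq => by
      apply Real.le_sqrt_of_sq_le
      rw [← hq.star_mul_self]
      exact le_maxNorm hq _
    calc maxNorm x ^ 2 ≤ √(maxNorm (star x * x)) ^ 2 := pow_le_pow_left₀ (h0 x) this 2
      _ = _ := Real.sq_sqrt (h0 _)

instance : SeminormedRing (AlgPower D n) where
  __ := AddGroupSeminorm.toSeminormedAddCommGroup
    { toFun := (maxNorm : AlgPower D n → ℝ)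
      map_zero' := by simpa using maxNorm_isCStarSeminorm.smul 0 (0 : AlgPower D n)
      add_le' := maxNorm_isCStarSeminorm.add_le
      neg' := fun x => by simpa using maxNorm_isCStarSeminorm.smul (-1) x }
  __ := (inferInstance : Ring (AlgPower D n))
  norm_mul_le := maxNorm_isCStarSeminorm.mul_le

lemma norm_eq (x : AlgPower D n) : ‖x‖ = maxNorm x := rfl

instance : NormedAlgebra ℂ (AlgPower D n) where
  norm_smul_le c x := (maxNorm_isCStarSeminorm.smul c x).le

lemma norm_star_mul_self (x : AlgPower D n) : ‖star x * x‖ = ‖x‖ ^ 2 :=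
  maxNorm_isCStarSeminorm.star_mul_self x

lemma norm_star_le (x : AlgPower D n) : ‖star x‖ ≤ ‖x‖ :=
  (maxNorm_isCStarSeminorm.map_star x).le

instance : NormedStarGroup (AlgPower D n) := ⟨norm_star_le⟩

lemma norm_map_le (f : AlgPower D n →⋆ₐ[ℂ] AlgPower D n) (x : AlgPower D n) : ‖f x‖ ≤ ‖x‖ :=
  maxNorm_le fun _ hq => le_maxNorm (hq.comp f) x

/-- The permutation `a₀ ⊗ ⋯ ⊗ aₙ₋₁ ↦ a_{σ 0} ⊗ ⋯ ⊗ a_{σ (n-1)}` of the tensor factors. -/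
def perm (σ : Equiv.Perm (Fin n)) : AlgPower D n →⋆ₐ[ℂ] AlgPower D n where
  toAlgHom := (PiTensorProduct.liftAlgHom (R := ℂ) (A := fun _ : Fin n => D)
    ((tmul (D := D) (n := n)).domDomCongr σ) rfl
    (fun x y => (tmul_mul_tmul (fun i => x (σ i)) (fun i => y (σ i))).symm) :)
  map_star' x := by
    let f : AlgPower D n →ₐ[ℂ] AlgPower D n :=
      (PiTensorProduct.liftAlgHom (R := ℂ) (A := fun _ : Fin n => D)
        ((tmul (D := D) (n := n)).domDomCongr σ) rfl
        (fun x y => (tmul_mul_tmul (fun i => x (σ i)) (fun i => y (σ i))).symm) :)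
    have hf (a : Fin n → D) : f (tmul a) = tmul (fun i => a (σ i)) :=
      PiTensorProduct.lift.tprod a
    change f (star x) = star (f x)
    induction x using induction with
    | h c a => rw [star_smul_tmul, map_smul, map_smul, hf, hf, star_smul_tmul]
    | hadd x y hx hy => rw [star_add, map_add, map_add, star_add, hx, hy]

lemma perm_tmul (σ : Equiv.Perm (Fin n)) (a : Fin n → D) :
    perm σ (tmul a) = tmul (fun i => a (σ i)) :=
  PiTensorProduct.lift.tprod a

lemma uniformContinuous_perm (σ : Equiv.Perm (Fin n)) :
    UniformContinuous (perm σ : AlgPower D n → AlgPower D n) :=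
  (LipschitzWith.of_dist_le_mul (K := 1) fun x y => by
    simpa [dist_eq_norm] using norm_map_le (perm σ) (x - y)).uniformContinuous

lemma continuous_perm (σ : Equiv.Perm (Fin n)) :
    Continuous (perm σ : AlgPower D n → AlgPower D n) :=
  (uniformContinuous_perm σ).continuous

end AlgPower

open UniformSpace

section Completion

variable {A : Type*} [SeminormedRing A] [StarRing A] [NormedStarGroup A]

lemma uniformContinuous_star : UniformContinuous (star : A → A) :=
  star_isometry.uniformContinuous

/-- The involution of a normed `⋆`-algebra, extended to its completion by continuity. -/
instance : InvolutiveStar (Completion A) where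
  star := Completion.map star
  star_involutive x := by
    induction x using Completion.induction_on with
    | hp =>
      exact isClosed_eq (Completion.continuous_map.comp Completion.continuous_map) continuous_id
    | ih a => rw [Completion.map_coe uniformContinuous_star,
        Completion.map_coe uniformContinuous_star, star_star]

lemma coe_star (x : A) : ((star x : A) : Completion A) = star (x : Completion A) :=
  (Completion.map_coe uniformContinuous_star x).symm

instance : ContinuousStar (Completion A) := ⟨Completion.continuous_map⟩

instance : StarRing (Completion A) where
  star_mul x y := by
    induction x, y using Completion.induction_on₂ with
    | hp => exact isClosed_eq (by fun_prop) (by fun_prop)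
    | ih a b => rw [← Completion.coe_mul, ← coe_star, ← coe_star, ← coe_star, star_mul,
        Completion.coe_mul]
  star_add x y := by
    induction x, y using Completion.induction_on₂ with
    | hp => exact isClosed_eq (by fun_prop) (by fun_prop)
    | ih a b => rw [← Completion.coe_add, ← coe_star, ← coe_star, ← coe_star, star_add,
        Completion.coe_add]

variable [NormedAlgebra ℂ A] [StarModule ℂ A]

lemma completion_star_smul (c : ℂ) (x : Completion A) : star (c • x) = star c • star x := by
  induction x using Completion.induction_on with
  | hp => exact isClosed_eq (continuous_star.comp (continuous_const_smul c))
            ((continuous_const_smul (star c)).comp continuous_star)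
  | ih a => rw [← Completion.coe_smul, ← coe_star, ← coe_star, star_smul, Completion.coe_smul]

/-- The completion of a unital `⋆`-algebra with respect to a C⋆-seminorm is a C⋆-algebra. -/
abbrev completionCStarAlgebra (h : ∀ x : A, ‖star x * x‖ = ‖x‖ ^ 2) :
    CStarAlgebra (Completion A) where
  __ := (inferInstance : NormedRing (Completion A))
  __ := (inferInstance : StarRing (Completion A))
  __ := (inferInstance : Algebra ℂ (Completion A))
  norm_smul_le := norm_smul_le
  complete := (inferInstance : CompleteSpace (Completion A)).complete
  star_smul := completion_star_smul
  norm_mul_self_le x := by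
    induction x using Completion.induction_on with
    | hp => exact isClosed_le (by fun_prop) (by fun_prop)
    | ih a => rw [← coe_star, ← Completion.coe_mul, Completion.norm_coe, Completion.norm_coe,
        h, sq]

/-- The extension of a `⋆`-homomorphism to the completions. -/
def completionMap (f : A →⋆ₐ[ℂ] A) (hf : UniformContinuous f) :
    Completion A →⋆ₐ[ℂ] Completion A where
  __ := Completion.mapRingHom (f : A →+* A) hf.continuous
  commutes' c := by
    change Completion.map f ((algebraMap ℂ A c : A) : Completion A) = _
    rw [Completion.map_coe hf, AlgHomClass.commutes]
    rfl
  map_star' x := by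
    change Completion.map f (star x) = star (Completion.map f x)
    induction x using Completion.induction_on with
    | hp =>
      exact isClosed_eq (Completion.continuous_map.comp continuous_star)
        (continuous_star.comp Completion.continuous_map)
    | ih a => rw [← coe_star, Completion.map_coe hf, Completion.map_coe hf, map_star, coe_star]

lemma completionMap_coe (f : A →⋆ₐ[ℂ] A) (hf : UniformContinuous f) (a : A) :
    completionMap f hf (a : Completion A) = (f a : A) :=
  Completion.map_coe hf a

end Completion

/-- The C⋆-tensor power `D^{⊗n}`: the completion of the algebraic tensor power in the maximal
C⋆-norm. For nuclear `D`, for instance UHF, every other C⋆-tensor product gives the same. -/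
def Power (D : Type*) [CStarAlgebra D] (n : ℕ) : Type _ := Completion (AlgPower D n)

namespace Power

variable {D : Type*} [CStarAlgebra D] {n : ℕ}

instance : CStarAlgebra (Power D n) :=
  completionCStarAlgebra (A := AlgPower D n) AlgPower.norm_star_mul_self

/-- The elementary tensor `a₀ ⊗ ⋯ ⊗ aₙ₋₁` in `D^{⊗n}`. -/
def tmul (a : Fin n → D) : Power D n :=
  ((AlgPower.tmul a : AlgPower D n) : Completion (AlgPower D n))

/-- The automorphism `α_σ` of `D^{⊗n}` that permutes the tensor factors,
`a₀ ⊗ ⋯ ⊗ aₙ₋₁ ↦ a_{σ 0} ⊗ ⋯ ⊗ a_{σ (n-1)}` (see `perm_tmul`). -/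
def perm (σ : Equiv.Perm (Fin n)) : Power D n →⋆ₐ[ℂ] Power D n :=
  completionMap (A := AlgPower D n) (AlgPower.perm σ) (AlgPower.uniformContinuous_perm σ)

lemma perm_tmul (σ : Equiv.Perm (Fin n)) (a : Fin n → D) :
    perm σ (tmul a) = tmul (fun i => a (σ i)) := by
  have := completionMap_coe (AlgPower.perm (D := D) σ) (AlgPower.uniformContinuous_perm σ)
    (AlgPower.tmul a)
  rw [AlgPower.perm_tmul] at this
  exact this

/-- The fixed point subalgebra `(D^{⊗n})^{S_n}` of the permutation action of `S_n`. -/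
def symFixed (D : Type*) [CStarAlgebra D] (n : ℕ) : StarSubalgebra ℂ (Power D n) :=
  ⨅ σ : Equiv.Perm (Fin n), StarAlgHom.equalizer (perm σ) (StarAlgHom.id ℂ (Power D n))

lemma mem_symFixed {x : Power D n} :
    x ∈ symFixed D n ↔ ∀ σ : Equiv.Perm (Fin n), perm σ x = x := by
  simp [symFixed, StarSubalgebra.mem_iInf]

end Power
end CStarTensor

namespace UHF

/-- A presentation of the unital C⋆-algebra `D` as a UHF algebra: an increasing sequence of
subalgebras, containing the unit of `D`, that are isomorphic to full matrix algebras and have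
dense union. -/
structure Presentation (D : Type*) [CStarAlgebra D] where
  /-- the sizes of the matrix algebras -/
  size : ℕ → ℕ
  size_pos : ∀ j, 0 < size j
  /-- the increasing sequence of unital subalgebras -/
  sub : ℕ → StarSubalgebra ℂ D
  mono : Monotone sub
  iso : ∀ j, Nonempty (sub j ≃⋆ₐ[ℂ] Matrix (Fin (size j)) (Fin (size j)) ℂ)
  dense : Dense (⋃ j, (sub j : Set D))

/-- The supernatural number `∏ q ^ (supernatural q)`: the exponent of the prime `q` is the
supremum of the exponents of `q` in the sizes of the matrix algebras. -/
def Presentation.supernatural {D : Type*} [CStarAlgebra D] (P : Presentation D) (q : ℕ) : ℕ∞ :=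
  ⨆ j, (padicValNat q (P.size j) : ℕ∞)

/-- Infinite type: each prime that appears in the supernatural number has exponent `∞`. -/
def Presentation.IsInfiniteType {D : Type*} [CStarAlgebra D] (P : Presentation D) : Prop :=
  ∀ q : ℕ, q.Prime → P.supernatural q ≠ 0 → P.supernatural q = ⊤

/-- The Hilbert space `ℓ²(ℕ)`. -/
abbrev Hilb : Type := lp (fun _ : ℕ => ℂ) 2

lemma sum_coord {ι : Type*} (t : Finset ι) (f : ι → Hilb) (m : ℕ) :
    (∑ i ∈ t, f i : Hilb) m = ∑ i ∈ t, f i m :=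
  map_sum (lp.evalCLM ℂ (fun _ : ℕ => ℂ) 2 m) f t

lemma index_inj {d : ℕ} (r : Fin d) : Function.Injective (fun q : ℕ => d * q + r) := by
  intro a b h
  have : 0 < d := r.pos
  simpa [this.ne'] using h

/-- `(compress r ξ)(q) = ξ (d * q + r)`. -/
def compress {d : ℕ} (r : Fin d) : Hilb →L[ℂ] Hilb :=
  have hp : 0 < (2 : ENNReal).toReal := by norm_num
  LinearMap.mkContinuous
    { toFun := fun ξ => ⟨fun q => ξ (d * q + r),
        memℓp_gen (((lp.memℓp ξ).summable hp).comp_injective (index_inj r))⟩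
      map_add' := fun _ _ => rfl
      map_smul' := fun _ _ => rfl } 1 (fun ξ => by
        rw [one_mul]
        refine lp.norm_le_of_tsum_le hp (norm_nonneg _) ?_
        rw [lp.norm_rpow_eq_tsum hp]
        exact tsum_comp_le_tsum_of_inj ((lp.memℓp ξ).summable hp)
          (fun _ => by positivity) (index_inj r))

lemma compress_apply {d : ℕ} (r : Fin d) (ξ : Hilb) (q : ℕ) :
    compress r ξ q = ξ (d * q + r) := rfl

open ContinuousLinearMap in
lemma adjoint_compress_apply {d : ℕ} (r : Fin d) (ξ : Hilb) (m : ℕ) :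
    adjoint (compress r) ξ m = if m % d = r then ξ (m / d) else 0 := by
  have h1 : adjoint (compress r) ξ m
      = inner ℂ (lp.single 2 m (1 : ℂ) : Hilb) (adjoint (compress r) ξ) := by
    rw [lp.inner_single_left]; simp
  have h2 : compress r (lp.single 2 m (1 : ℂ) : Hilb)
      = if m % d = r then (lp.single 2 (m / d) (1 : ℂ) : Hilb) else 0 := by
    ext q
    rw [compress_apply]
    have hd := r.pos
    have hr := r.2
    split_ifs with h
    · by_cases hq : q = m / d
      · subst hq
        have : d * (m / d) + r = m := by rw [← h]; exact Nat.div_add_mod m d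
        simp [lp.single_apply, this]
      · have : d * q + r ≠ m := by
          rintro rfl
          apply hq
          rw [Nat.mul_add_div hd, Nat.div_eq_of_lt hr, add_zero]
        simp [lp.single_apply, Pi.single_eq_of_ne this, Pi.single_eq_of_ne hq]
    · have : d * q + r ≠ m := by
        rintro rfl
        apply h
        rw [Nat.mul_add_mod, Nat.mod_eq_of_lt hr]
      simp [lp.single_apply, Pi.single_eq_of_ne this]
  rw [h1, adjoint_inner_right, h2]
  split_ifs
  · rw [lp.inner_single_left]; simp
  · simp

/-- The matrix unit `δ_{dq+s} ↦ δ_{dq+r}` (for all `q`), `δ_m ↦ 0` for `m ≢ s` mod `d`. -/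
def unit {d : ℕ} (r s : Fin d) : Hilb →L[ℂ] Hilb :=
  ContinuousLinearMap.adjoint (compress r) * compress s

lemma unit_apply {d : ℕ} (r s : Fin d) (ξ : Hilb) (m : ℕ) :
    unit r s ξ m = if m % d = r then ξ (d * (m / d) + s) else 0 := by
  change ContinuousLinearMap.adjoint (compress r) (compress s ξ) m = _
  rw [adjoint_compress_apply, compress_apply]

lemma star_unit {d : ℕ} (r s : Fin d) : star (unit r s) = unit s r := by
  simp [unit, ← ContinuousLinearMap.star_eq_adjoint]

/-- The linear map `a ↦ ∑ a r s • unit r s` underlying `amp`. -/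
def ampLin (d : ℕ) : Matrix (Fin d) (Fin d) ℂ →ₗ[ℂ] (Hilb →L[ℂ] Hilb) where
  toFun a := ∑ r, ∑ s, a r s • unit r s
  map_add' a b := by simp [add_smul, Finset.sum_add_distrib]
  map_smul' c a := by simp [Finset.smul_sum, mul_smul]

lemma ampLin_apply (d : ℕ) [NeZero d] (a : Matrix (Fin d) (Fin d) ℂ) (ξ : Hilb) (m : ℕ) :
    ampLin d a ξ m = ∑ s : Fin d, a (Fin.ofNat d m) s * ξ (d * (m / d) + s) := by
  have h : ampLin d a ξ = ∑ r, ∑ s, a r s • unit r s ξ := by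
    change (∑ r, ∑ s, a r s • unit r s : Hilb →L[ℂ] Hilb) ξ = _
    simp
  have h' (r s : Fin d) : (a r s • unit r s ξ : Hilb) m
      = if Fin.ofNat d m = r then a r s * ξ (d * (m / d) + s) else 0 := by
    have e : (m % d = r) ↔ Fin.ofNat d m = r := by simp [Fin.ext_iff, Fin.ofNat]
    change a r s * unit r s ξ m = _
    rw [unit_apply]
    simp only [e]
    split_ifs <;> simp
  rw [h]
  simp only [sum_coord, h']
  rw [Finset.sum_comm]
  simp

/-- The unital representation `a ↦ 1 ⊗ a` of `M_d` on `ℓ²(ℕ) = ℓ²(ℕ) ⊗ ℂ^d`, where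
`δ_q ⊗ e_r = δ_{dq+r}` (see `amp_apply`). -/
def amp (d : ℕ) [NeZero d] : Matrix (Fin d) (Fin d) ℂ →⋆ₐ[ℂ] (Hilb →L[ℂ] Hilb) where
  toAlgHom := AlgHom.ofLinearMap (ampLin d)
    (by
      ext ξ m
      rw [ampLin_apply]
      simp [Matrix.one_apply, Nat.div_add_mod])
    (fun a b => by
      ext ξ m
      change _ = ampLin d a (ampLin d b ξ) m
      have h1 (s : Fin d) : Fin.ofNat d (d * (m / d) + s) = s := by
        simp [Fin.ext_iff, Fin.ofNat, Nat.mod_eq_of_lt s.2]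
      have h2 (s : Fin d) : (d * (m / d) + s) / d = m / d := by
        rw [Nat.mul_add_div (NeZero.pos d), Nat.div_eq_of_lt s.2, add_zero]
      simp only [ampLin_apply, h1, h2, Matrix.mul_apply, Finset.mul_sum, Finset.sum_mul]
      rw [Finset.sum_comm]
      simp only [mul_assoc])
  map_star' a := by
    change ∑ r, ∑ s, (star a) r s • unit r s = star (∑ r, ∑ s, a r s • unit r s)
    simp only [star_sum, star_smul, star_unit, Matrix.star_apply]
    exact Finset.sum_comm

/-- The UHF algebra `M_{p^∞}`: the closure, in the bounded operators on `ℓ²(ℕ)`, of the union of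
the increasing sequence `M_1 ⊆ M_p ⊆ M_{p²} ⊆ ⋯` of algebras of operators, with connecting maps
`a ↦ 1 ⊗ a`. See `mInftyPresentation`. -/
def mInfty (p : ℕ) [NeZero p] : StarSubalgebra ℂ (Hilb →L[ℂ] Hilb) :=
  (⨆ j : ℕ, (amp (p ^ j)).range).topologicalClosure

instance (p : ℕ) [NeZero p] : CStarAlgebra (mInfty p) :=
  have : IsClosed (mInfty p : Set (Hilb →L[ℂ] Hilb)) :=
    StarSubalgebra.isClosed_topologicalClosure _
  inferInstance

lemma amp_apply (d : ℕ) [NeZero d] (a : Matrix (Fin d) (Fin d) ℂ) (ξ : Hilb) (m : ℕ) :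
    amp d a ξ m = ∑ s : Fin d, a (Fin.ofNat d m) s * ξ (d * (m / d) + s) :=
  ampLin_apply d a ξ m

lemma amp_injective (d : ℕ) [NeZero d] : Function.Injective (amp d) := by
  intro a b h
  ext i j
  have h' := congrArg (fun T : Hilb →L[ℂ] Hilb => T (lp.single 2 (j : ℕ) (1 : ℂ)) (i : ℕ)) h
  have e : Fin.ofNat d (i : ℕ) = i := by simp [Fin.ext_iff, Fin.ofNat, Nat.mod_eq_of_lt i.2]
  simpa [amp_apply, e, Nat.div_eq_of_lt i.2, lp.single_apply, Pi.single_apply, Fin.val_inj] using h'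

lemma amp_range_le {d e N : ℕ} [NeZero d] [NeZero e] [NeZero N] (hN : N = e * d) :
    (amp d).range ≤ (amp N).range := by
  subst hN
  rintro _ ⟨a, rfl⟩
  refine ⟨Matrix.of fun i j =>
    if (i : ℕ) / d = j / d then a (Fin.ofNat d i) (Fin.ofNat d j) else 0, ?_⟩
  change amp (e * d) _ = amp d a
  ext ξ m
  rw [amp_apply (e * d), amp_apply d, ← finProdFinEquiv.sum_comp, Fintype.sum_prod_type]
  have hd : 0 < d := NeZero.pos d
  have he : 0 < e := NeZero.pos e
  have h1 (k : Fin e) (s : Fin d) : ((finProdFinEquiv (k, s) : Fin (e * d)) : ℕ) / d = k := by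
    simp [Nat.add_mul_div_left _ _ hd, Nat.div_eq_of_lt s.2]
  have h2 (k : Fin e) (s : Fin d) : Fin.ofNat d (finProdFinEquiv (k, s) : Fin (e * d)) = s := by
    simp [Fin.ext_iff, Fin.ofNat, Nat.mod_eq_of_lt s.2]
  have h3 : Fin.ofNat d (Fin.ofNat (e * d) m) = Fin.ofNat d m := by
    simp [Fin.ext_iff, Fin.ofNat, Nat.mod_mul_left_mod]
  have h4 (k : Fin e) :
      ((Fin.ofNat (e * d) m : Fin (e * d)) : ℕ) / d = k ↔ Fin.ofNat e (m / d) = k := by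
    simp [Fin.ext_iff, Fin.ofNat, mul_comm e d, Nat.mod_mul_right_div_self]
  simp only [Matrix.of_apply, h1, h2, h3, h4, ite_mul, zero_mul]
  rw [Finset.sum_comm]
  refine Finset.sum_congr rfl fun s _ => ?_
  rw [Finset.sum_ite_eq]
  simp only [Finset.mem_univ, if_true]
  congr 2
  have h5 : d * (m / d) = e * d * (m / d / e) + d * (m / d % e) := by
    rw [mul_comm e d, mul_assoc, ← mul_add, Nat.div_add_mod]
  simp only [finProdFinEquiv_apply_val, Fin.val_ofNat]
  rw [h5, Nat.div_div_eq_div_mul, mul_comm d e]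
  rw [add_assoc, add_comm (s : ℕ)]

/-- `M_{p^∞}` is UHF with matrix algebras `M_{p^j}`, so its supernatural number is `p^∞`. -/
def mInftyPresentation (p : ℕ) [NeZero p] : Presentation (mInfty p) where
  size j := p ^ j
  size_pos j := NeZero.pos _
  sub j := ((amp (p ^ j)).range).comap (mInfty p).subtype
  mono := monotone_nat_of_le_succ fun j x hx => by
    have : (amp (p ^ j)).range ≤ (amp (p ^ (j + 1))).range := amp_range_le (pow_succ' p j)
    exact this hx
  iso j := by
    have hle (a) : amp (p ^ j) a ∈ mInfty p :=
      StarSubalgebra.le_topologicalClosure _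
        ((le_iSup (fun j : ℕ => (amp (p ^ j)).range) j) ⟨a, rfl⟩)
    let f : Matrix (Fin (p ^ j)) (Fin (p ^ j)) ℂ →⋆ₐ[ℂ]
        ((amp (p ^ j)).range).comap (mInfty p).subtype :=
      ((amp (p ^ j)).codRestrict (mInfty p) hle).codRestrict _ (fun a => ⟨a, rfl⟩)
    refine ⟨(StarAlgEquiv.ofBijective f ⟨fun a b h => amp_injective _ ?_, ?_⟩).symm⟩
    · exact congrArg (fun x : ((amp (p ^ j)).range).comap (mInfty p).subtype =>
        ((x : mInfty p) : Hilb →L[ℂ] Hilb)) h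
    · rintro ⟨⟨x, hx⟩, ⟨a, ha⟩⟩
      exact ⟨a, Subtype.ext (Subtype.ext ha)⟩
  dense := by
    have hdir : Directed (· ≤ ·) (fun j : ℕ => (amp (p ^ j)).range) :=
      (monotone_nat_of_le_succ fun j => amp_range_le (pow_succ' p j)).directed_le
    rw [Subtype.dense_iff]
    intro x hx
    have hx' : x ∈ closure
        ((⨆ j : ℕ, (amp (p ^ j)).range : StarSubalgebra ℂ (Hilb →L[ℂ] Hilb)) : Set _) := hx
    refine closure_mono ?_ hx'
    rw [StarSubalgebra.coe_iSup_of_directed hdir]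
    intro y hy
    obtain ⟨j, hj⟩ := Set.mem_iUnion.1 hy
    refine ⟨⟨y, StarSubalgebra.le_topologicalClosure _
      ((le_iSup (fun j : ℕ => (amp (p ^ j)).range) j) hj)⟩, Set.mem_iUnion.2 ⟨j, hj⟩, rfl⟩

end UHF

end

noncomputable section

universe u

open scoped ComplexOrder

/-! It suffices to find, in the fixed point algebra, a sequence of mutually commuting unital copies
of `M_p`: the products of the first `j` of them are compatible copies of `M_{p^j}`, and these extend
to `M_{p^∞}`.

One copy of `M_p` comes from a unital copy of `M_{p^N}` in `D`, with matrix units indexed by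
`ℤ/p^N`. Its `n`-th tensor power has matrix units indexed by `X = (ℤ/p^N)^n`, on which `S_n`
permutes coordinates and `ℤ` acts by diagonal translation; the two actions commute. Given an
`S_n`-invariant colouring `c : X → ℤ/p` with `c (x + k) = c x + k`, the sums of the units `(x + r -
s, x)` over `c x = s` are `p × p` matrix units (`IsMatrixUnits.shift`), and they are fixed by `S_n`
because `c` is (`symUnits_mem`). The colouring (`exists_symmetric_coloring`): write `n = p^a b` with
`p ∤ b` and take `N = a + 1`. Translation by `1` adds `p^a b` to the coordinate sum in `ℤ/p^(a+1)`,
so the leading digit of the sum grows by `b` modulo `p`; dividing that digit by `b` gives `c`.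

Commuting copies of `M_{p^N}` in `D` exist because the exponent of `p` is infinite: the commutant of
`A_j` in a later `A_{j'}` is a matrix algebra of size `k_{j'} / k_j`, which is divisible by `p^N`
for a suitable `j'` (`exists_commuting_sequence`). Elementwise commuting systems in `D` give
commuting systems in the tensor power.

Injectivity needs the maximal tensor power to be nonzero. This follows from a nonzero C⋆-seminorm on
the algebraic tensor power, obtained by tensoring a GNS representation of `D` with itself. -/

/-! ### Matrix units and homomorphisms from matrix algebras -/

/-- A family of `ι × ι` matrix units in a unital `⋆`-ring, with sum of the diagonal ones `1`. -/
structure IsMatrixUnits {ι A : Type*} [Fintype ι] [DecidableEq ι] [Ring A] [StarRing A]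
    (u : ι → ι → A) : Prop where
  mul : ∀ i j k l, u i j * u k l = if j = k then u i l else 0
  star : ∀ i j, star (u i j) = u j i
  sum : ∑ i, u i i = 1

namespace IsMatrixUnits

section
variable {ι A : Type*} [Fintype ι] [DecidableEq ι] [Ring A] [StarRing A] {u : ι → ι → A}

lemma mul_same (h : IsMatrixUnits u) (i j k : ι) : u i j * u j k = u i k := by
  simp [h.mul]

lemma map {B F : Type*} [Ring B] [StarRing B] [FunLike F A B] [RingHomClass F A B]
    [StarHomClass F A B] (h : IsMatrixUnits u) (f : F) : IsMatrixUnits fun i j => f (u i j) where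
  mul i j k l := by rw [← map_mul, h.mul]; split_ifs <;> simp
  star i j := by rw [← map_star, h.star]
  sum := by rw [← map_sum, h.sum, map_one]

lemma reindex {κ : Type*} [Fintype κ] [DecidableEq κ] (h : IsMatrixUnits u) (e : κ ≃ ι) :
    IsMatrixUnits fun i j => u (e i) (e j) where
  mul i j k l := by simp [h.mul]
  star i j := h.star _ _
  sum := by rw [e.sum_comp fun i => u i i, h.sum]

lemma codRestrict [Algebra ℂ A] [StarModule ℂ A] (h : IsMatrixUnits u) (S : StarSubalgebra ℂ A)
    (hS : ∀ i j, u i j ∈ S) : IsMatrixUnits fun i j => (⟨u i j, hS i j⟩ : S) where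
  mul i j k l := by
    apply Subtype.ext
    change u i j * u k l = _
    rw [h.mul]
    split_ifs <;> rfl
  star i j := Subtype.ext (h.star i j)
  sum := by
    apply Subtype.ext
    rw [AddSubmonoidClass.coe_finsetSum]
    exact h.sum

variable [Algebra ℂ A] [StarModule ℂ A]

/-- The unital `⋆`-homomorphism from the matrix algebra defined by a family of matrix units. -/
def hom (h : IsMatrixUnits u) : Matrix ι ι ℂ →⋆ₐ[ℂ] A where
  toAlgHom := AlgHom.ofLinearMap
    { toFun := fun a => ∑ i, ∑ j, a i j • u i j
      map_add' := fun a b => by simp [add_smul, Finset.sum_add_distrib]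
      map_smul' := fun c a => by simp [Finset.smul_sum, mul_smul] }
    (by simp [Matrix.one_apply, h.sum])
    (fun a b => by
      simp only [LinearMap.coe_mk, AddHom.coe_mk, Matrix.mul_apply, Finset.sum_smul,
        Finset.sum_mul, Finset.mul_sum, smul_mul_smul_comm, h.mul, smul_ite, smul_zero]
      simp only [Finset.sum_ite_eq', Finset.mem_univ, if_true]
      rw [Finset.sum_comm]
      refine Eq.trans (Finset.sum_congr rfl fun l _ => Finset.sum_comm) Finset.sum_comm)
  map_star' a := by
    change ∑ i, ∑ j, (Star.star a) i j • u i j = Star.star (∑ i, ∑ j, a i j • u i j)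
    simp only [star_sum, star_smul, h.star, Matrix.star_apply]
    exact Finset.sum_comm

lemma hom_apply (h : IsMatrixUnits u) (a : Matrix ι ι ℂ) :
    h.hom a = ∑ i, ∑ j, a i j • u i j := rfl

end

lemma single (ι : Type*) [Fintype ι] [DecidableEq ι] :
    IsMatrixUnits fun i j : ι => (Matrix.single i j 1 : Matrix ι ι ℂ) where
  mul i j k l := by
    split_ifs with h
    · subst h; simp
    · simp [h]
  star i j := by simp [Matrix.star_eq_conjTranspose]
  sum := Matrix.sum_single_one

end IsMatrixUnits

/-! ### Matrix units in tensor powers -/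

namespace CStarTensor.Power

variable {D : Type*} [CStarAlgebra D] {n : ℕ}

lemma tmul_mul_tmul (a b : Fin n → D) : (tmul a * tmul b : Power D n) = tmul (a * b) := by
  change ((AlgPower.tmul a : AlgPower D n) : UniformSpace.Completion (AlgPower D n))
    * ((AlgPower.tmul b : AlgPower D n) : UniformSpace.Completion (AlgPower D n)) = _
  rw [← UniformSpace.Completion.coe_mul, AlgPower.tmul_mul_tmul]
  rfl

lemma star_tmul (a : Fin n → D) : star (tmul a : Power D n) = tmul (star a) := by
  change star ((AlgPower.tmul a : AlgPower D n) : UniformSpace.Completion (AlgPower D n)) = _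
  rw [← coe_star, AlgPower.star_tmul]
  rfl

lemma tmul_one : (tmul 1 : Power D n) = 1 := rfl

lemma tmul_eq_zero (a : Fin n → D) (i : Fin n) (h : a i = 0) : (tmul a : Power D n) = 0 := by
  have : (AlgPower.tmul a : AlgPower D n) = 0 := AlgPower.tmul.map_coord_zero i h
  change ((AlgPower.tmul a : AlgPower D n) : UniformSpace.Completion (AlgPower D n)) = 0
  rw [this]
  exact UniformSpace.Completion.coe_zero

lemma sum_tmul {ι : Type*} [Fintype ι] (f : ι → D) :
    (∑ x : Fin n → ι, tmul fun i => f (x i) : Power D n) = tmul fun _ => ∑ a, f a := by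
  have h : (∑ x : Fin n → ι, AlgPower.tmul fun i => f (x i) : AlgPower D n)
      = AlgPower.tmul fun _ => ∑ a, f a :=
    (AlgPower.tmul.map_sum fun (_ : Fin n) a => f a).symm
  change _ = ((AlgPower.tmul fun _ => ∑ a, f a : AlgPower D n) :
    UniformSpace.Completion (AlgPower D n))
  rw [← h]
  exact (map_sum (UniformSpace.Completion.coeRingHom (α := AlgPower D n)) _ _).symm

/-- This is `M_ι^{⊗n} = M_{ι^n}`; with words as indices, permuting tensor factors becomes permuting
the letters of both indices. -/
lemma _root_.IsMatrixUnits.tensorPower {ι : Type*} [Fintype ι] [DecidableEq ι] {u : ι → ι → D}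
    (h : IsMatrixUnits u) (n : ℕ) :
    IsMatrixUnits fun x y : Fin n → ι => (tmul fun i => u (x i) (y i) : Power D n) where
  mul x y z w := by
    rw [tmul_mul_tmul]
    split_ifs with hyz
    · subst hyz
      congr 1
      funext i
      exact h.mul_same _ _ _
    · obtain ⟨i, hi⟩ := Function.ne_iff.1 hyz
      exact tmul_eq_zero _ i (by simp [h.mul, hi])
  star x y := by
    rw [star_tmul]
    congr 1
    funext i
    exact h.star _ _
  sum := by
    rw [sum_tmul fun a => u a a, h.sum]
    exact tmul_one

lemma isClosed_symFixed : IsClosed (symFixed D n : Set (Power D n)) := by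
  have hc (σ : Equiv.Perm (Fin n)) : Continuous (perm σ : Power D n → Power D n) :=
    UniformSpace.Completion.continuous_map
  have : (symFixed D n : Set (Power D n)) = ⋂ σ : Equiv.Perm (Fin n), {x | perm σ x = x} := by
    ext x
    simp [mem_symFixed]
  rw [this]
  exact isClosed_iInter fun σ => isClosed_eq (hc σ) continuous_id

end CStarTensor.Power

/-! ### Symmetric matrix units from an invariant colouring -/

/-- Matrix units obtained by shifting along the fibres of a colouring: if `c (τ k x) = c x + k`
for an action `τ` of `ℤ`, then the `Σ_{c x = s} u (τ (r - s) x) x` are matrix units. -/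
lemma IsMatrixUnits.shift {X A : Type*} [Fintype X] [DecidableEq X] [Ring A] [StarRing A]
    {u : X → X → A} (h : IsMatrixUnits u) {p : ℕ} [NeZero p] (c : X → ZMod p)
    (τ : ℤ → X → X) (h0 : ∀ x, τ 0 x = x) (hadd : ∀ k l x, τ (k + l) x = τ k (τ l x))
    (hc : ∀ k x, c (τ k x) = c x + k) :
    IsMatrixUnits fun r s : Fin p =>
      ∑ x with c x = ((s : ℕ) : ZMod p), u (τ ((r : ℤ) - s) x) x where
  mul r s s' t := by
    have hshift (x : X) (hx : c x = ((t : ℕ) : ZMod p)) (k : ℕ) :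
        c (τ ((k : ℤ) - t) x) = (k : ZMod p) := by
      rw [hc, hx]; push_cast; ring
    rw [Finset.sum_mul_sum]
    simp only [h.mul]
    split_ifs with hs
    · subst hs
      rw [Finset.sum_comm]
      refine Finset.sum_congr rfl fun x hx => ?_
      rw [Finset.mem_filter] at hx
      -- Only `y = τ (s - t) x` contributes. The shifts are integer differences of representatives,
      -- so `(r - s) + (s - t) = r - t` holds exactly; differences modulo `p` would not act on `X`.
      rw [Finset.sum_ite_eq_of_mem', ← hadd]
      · congr 2; ring
      · simpa using hshift x hx.2 s
    · refine Finset.sum_eq_zero fun y hy => Finset.sum_eq_zero fun x hx => ?_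
      rw [Finset.mem_filter] at hx hy
      rw [if_neg]
      rintro rfl
      have e := hshift x hx.2 s'
      rw [hy.2, ZMod.natCast_eq_natCast_iff', Nat.mod_eq_of_lt s.2, Nat.mod_eq_of_lt s'.2] at e
      exact hs (Fin.ext e)
  star r s := by
    simp only [star_sum, h.star]
    -- Shifting by `r - s` carries colour class `s` bijectively onto colour class `r`.
    refine Finset.sum_nbij' (fun x => τ ((r : ℤ) - s) x) (fun x => τ ((s : ℤ) - r) x) ?_ ?_ ?_ ?_ ?_
    · intro x hx
      simp only [Finset.mem_filter, Finset.mem_univ, true_and] at hx ⊢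
      rw [hc, hx]; push_cast; ring
    · intro x hx
      simp only [Finset.mem_filter, Finset.mem_univ, true_and] at hx ⊢
      rw [hc, hx]; push_cast; ring
    · intro x _; rw [← hadd]; simp [h0]
    · intro x _; rw [← hadd]; simp [h0]
    · intro x _; rw [← hadd]; simp [h0]
  sum := by
    simp only [sub_self, h0]
    rw [← h.sum, ← Finset.sum_fiberwise Finset.univ c]
    refine Fintype.sum_bijective (fun r : Fin p => ((r : ℕ) : ZMod p)) ?_ _ _ fun r => rfl
    refine ⟨fun r s e => ?_, fun z => ⟨⟨z.val, z.val_lt⟩, by simp⟩⟩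
    rw [ZMod.natCast_eq_natCast_iff', Nat.mod_eq_of_lt r.2, Nat.mod_eq_of_lt s.2] at e
    exact Fin.ext e

/-- Adding a multiple of `p ^ a` leaves the `a` lower digits alone, so no carry reaches the leading
digit; its own overflow vanishes both modulo `p ^ (a + 1)` and modulo `p`. -/
lemma ZMod.natCast_val_add_div {p a : ℕ} [NeZero p] (y : ZMod (p ^ (a + 1))) (k : ℕ) :
    (((y + ((p ^ a * k : ℕ) : ZMod (p ^ (a + 1)))).val / p ^ a : ℕ) : ZMod p)
      = ((y.val / p ^ a : ℕ) : ZMod p) + k := by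
  have hpos : 0 < p ^ a := NeZero.pos _
  rw [ZMod.val_add, ZMod.val_natCast, Nat.add_mod_mod]
  generalize y.val = v
  rw [pow_succ, Nat.mod_mul_right_div_self, ZMod.natCast_mod, Nat.add_mul_div_left _ _ hpos, Nat.cast_add]

/-- A permutation invariant colouring of `(ℤ/p^N)^n` that intertwines the diagonal translations
with the translations of `ℤ/p`. -/
lemma exists_symmetric_coloring (p : ℕ) [Fact p.Prime] {n : ℕ} (hn : 0 < n) :
    ∃ (N : ℕ) (c : (Fin n → ZMod (p ^ N)) → ZMod p),
      (∀ (σ : Equiv.Perm (Fin n)) x, c (fun i => x (σ i)) = c x) ∧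
      ∀ (k : ℤ) x, c (fun i => x i + k) = c x + k := by
  -- Diagonal translation by `1` adds `n` to the coordinate sum. The exponent `a + 1` is the first
  -- at which `n = p ^ a * b` is nonzero in `ℤ/p^(a+1)`; it then moves the leading digit by `b`, a
  -- unit modulo `p`.
  obtain ⟨a, b, hb, hab⟩ := Nat.exists_eq_pow_mul_and_not_dvd hn.ne' p (Fact.out : p.Prime).ne_one
  have hb0 : (b : ZMod p) ≠ 0 := by rwa [Ne, ZMod.natCast_eq_zero_iff]
  let c : (Fin n → ZMod (p ^ (a + 1))) → ZMod p := fun x =>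
    (b : ZMod p)⁻¹ * (((∑ i, x i).val / p ^ a : ℕ) : ZMod p)
  have hone (x : Fin n → ZMod (p ^ (a + 1))) : c (fun i => x i + 1) = c x + 1 := by
    have e : ∑ i, (x i + 1) = ∑ i, x i + ((p ^ a * b : ℕ) : ZMod (p ^ (a + 1))) := by
      rw [Finset.sum_add_distrib, ← hab]; simp
    have := ZMod.natCast_val_add_div (p := p) (a := a) (∑ i, x i) b
    change (b : ZMod p)⁻¹ * _ = (b : ZMod p)⁻¹ * _ + 1
    rw [e, this, mul_add, inv_mul_cancel₀ hb0]
  refine ⟨a + 1, c, fun σ x => ?_, fun k => ?_⟩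
  · change _ * (((∑ i, x (σ i)).val / p ^ a : ℕ) : ZMod p) = _
    rw [Equiv.sum_comp σ x]
  · induction k using Int.induction_on with
    | zero => simp
    | succ k ih =>
      intro x
      have := hone fun i => x i + (k : ℤ)
      rw [ih] at this
      push_cast at this ⊢
      rw [← add_assoc, ← this]
      simp only [add_assoc]
    | pred k ih =>
      intro x
      have := hone fun i => x i + (-(k : ℤ) - 1 : ℤ)
      have e : (fun i => x i + ((-(k : ℤ) - 1 : ℤ) : ZMod (p ^ (a + 1))) + 1)
          = fun i => x i + ((-(k : ℤ) : ℤ) : ZMod (p ^ (a + 1))) := by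
        funext i; push_cast; ring
      rw [e, ih] at this
      rw [← sub_eq_iff_eq_add.2 this]
      push_cast; ring

namespace CStarTensor.Power

variable {D : Type*} [CStarAlgebra D] {n : ℕ}

/-- The matrix units in the symmetric part of `D^{⊗n}` defined by matrix units `u` in `D` and a
colouring. -/
def symUnits {m p : ℕ} [NeZero m] (c : (Fin n → ZMod m) → ZMod p) (u : ZMod m → ZMod m → D)
    (r s : Fin p) : Power D n :=
  ∑ x with c x = ((s : ℕ) : ZMod p), tmul fun i => u (x i + ((r : ℤ) - s : ℤ)) (x i)

variable {m p : ℕ} [NeZero m] {c : (Fin n → ZMod m) → ZMod p} {u v : ZMod m → ZMod m → D}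

lemma isMatrixUnits_symUnits [NeZero p] (hc : ∀ (k : ℤ) x, c (fun i => x i + k) = c x + k)
    (hu : IsMatrixUnits u) : IsMatrixUnits (symUnits c u) :=
  (hu.tensorPower n).shift c (fun k x i => x i + k) (fun x => by simp)
    (fun k l x => by funext i; push_cast; ring) hc

/-- A permutation of the factors commutes with the diagonal translation and preserves the colour
classes, so it only reorders the terms of the sum. -/
lemma symUnits_mem (hc : ∀ (σ : Equiv.Perm (Fin n)) x, c (fun i => x (σ i)) = c x) (r s : Fin p) :
    symUnits c u r s ∈ symFixed D n := by
  rw [mem_symFixed]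
  intro σ
  rw [symUnits, map_sum]
  simp only [perm_tmul]
  refine Finset.sum_nbij' (fun x i => x (σ i)) (fun x i => x (σ.symm i)) ?_ ?_ ?_ ?_ ?_
  · intro x hx
    simpa [hc] using hx
  · intro x hx
    simpa [hc σ.symm] using hx
  · intro x _; simp
  · intro x _; simp
  · intro x _; rfl

lemma commute_symUnits (h : ∀ i j k l, Commute (u i j) (v k l)) (r s r' s' : Fin p) :
    Commute (symUnits c u r s) (symUnits c v r' s') := by
  refine Commute.sum_left _ _ _ fun x _ => Commute.sum_right _ _ _ fun y _ => ?_
  change _ * _ = _ * _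
  rw [tmul_mul_tmul, tmul_mul_tmul]
  congr 1
  funext i
  exact h _ _ _ _

end CStarTensor.Power

/-! ### Relative commutants in matrix algebras -/

open Matrix in
/-- A self-adjoint idempotent matrix is `F * Fᴴ` for an isometry `F`. -/
lemma Matrix.exists_isometry_of_isHermitian_of_idempotent {l : Type*} [Fintype l] [DecidableEq l]
    {P : Matrix l l ℂ} (h : P.IsHermitian) (hi : P * P = P) :
    ∃ (s : Set l) (_ : Fintype s) (F : Matrix l s ℂ), Fᴴ * F = 1 ∧ F * Fᴴ = P := by
  classical
  set U : Matrix l l ℂ := h.eigenvectorUnitary.1 with hU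
  set d : l → ℂ := RCLike.ofReal ∘ h.eigenvalues with hd
  have hUU : Uᴴ * U = 1 := Unitary.coe_star_mul_self _
  have hP : P = U * diagonal d * Uᴴ := by
    conv_lhs => rw [h.spectral_theorem]
    rw [Unitary.conjStarAlgAut_apply]
    rfl
  have hdd : diagonal d * diagonal d = diagonal d := by
    have e : Uᴴ * P * U = diagonal d := by
      rw [hP]
      calc Uᴴ * (U * diagonal d * Uᴴ) * U = (Uᴴ * U) * diagonal d * (Uᴴ * U) := by
            simp only [Matrix.mul_assoc]
        _ = _ := by rw [hUU, Matrix.one_mul, Matrix.mul_one]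
    have hUU' : U * Uᴴ = 1 := Unitary.coe_mul_star_self _
    calc diagonal d * diagonal d = Uᴴ * P * (U * Uᴴ) * P * U := by
          rw [← e]; simp only [Matrix.mul_assoc]
      _ = Uᴴ * (P * P) * U := by rw [hUU', Matrix.mul_one]; simp only [Matrix.mul_assoc]
      _ = _ := by rw [hi, e]
  have hd01 (i : l) : d i = 0 ∨ d i = 1 := by
    have := congrFun (congrFun hdd i) i
    rw [diagonal_mul_diagonal, diagonal_apply_eq, diagonal_apply_eq] at this
    rcases eq_or_ne (d i) 0 with h0 | h0
    · exact .inl h0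
    · exact .inr (mul_left_cancel₀ h0 (by rw [this, mul_one]))
  -- The columns of `F` are the eigenvectors for the eigenvalue `1`.
  refine ⟨{i | d i = 1}, inferInstance, U.submatrix id Subtype.val, ?_, ?_⟩
  · rw [conjTranspose_submatrix, ← Matrix.submatrix_mul _ _ _ id _ Function.bijective_id, hUU]
    exact submatrix_one _ Subtype.val_injective
  · ext a b
    rw [hP, Matrix.mul_apply, Matrix.mul_apply]
    simp only [conjTranspose_apply, submatrix_apply, id, mul_diagonal]
    refine (Finset.sum_subtype (Finset.univ.filter fun i => d i = 1) (by simp)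
      fun i => U a i * star (U b i)).symm.trans ?_
    rw [Finset.sum_filter]
    refine Finset.sum_congr rfl fun i _ => ?_
    rcases hd01 i with h0 | h0 <;> simp [h0]

namespace IsMatrixUnits

/-- These are the units `e_ij ⊗ 1` of the first tensor factor of `M_ι ⊗ M_τ`. -/
lemma sum_snd {ι τ A : Type*} [Fintype ι] [DecidableEq ι] [Fintype τ] [DecidableEq τ] [Ring A]
    [StarRing A] {u : ι × τ → ι × τ → A} (h : IsMatrixUnits u) :
    IsMatrixUnits fun i j => ∑ k, u (i, k) (j, k) where
  mul i j k l := by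
    simp only [Finset.sum_mul_sum, h.mul, Prod.mk.injEq]
    split_ifs with hjk <;> simp [hjk]
  star i j := by simp [h.star]
  sum := by rw [← h.sum, Fintype.sum_prod_type]

variable {κ l : Type*} [Fintype κ] [DecidableEq κ] [Fintype l] [DecidableEq l]
  {E : κ → κ → Matrix l l ℂ}

/-- The diagonal units are equivalent projections, hence of equal trace, and they sum to `1`. -/
lemma card_mul_trace (h : IsMatrixUnits E) (i : κ) :
    (Fintype.card κ : ℂ) * (E i i).trace = Fintype.card l := by
  have htr (j : κ) : (E j j).trace = (E i i).trace := by
    rw [← h.mul_same j i j, Matrix.trace_mul_comm, h.mul_same]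
  rw [← Matrix.trace_one (R := ℂ) (n := l), ← h.sum, Matrix.trace_sum]
  simp [htr]

/-- The isometry identifies `ℂ^s` with the range of `E i i`; its dimension is the trace of that
projection. -/
lemma exists_isometry (h : IsMatrixUnits E) (i : κ) :
    ∃ (s : Set l) (_ : Fintype s) (F : Matrix l s ℂ), F.conjTranspose * F = 1 ∧
      F * F.conjTranspose = E i i ∧ Fintype.card κ * Fintype.card s = Fintype.card l := by
  classical
  obtain ⟨s, hs, F, h1, h2⟩ := Matrix.exists_isometry_of_isHermitian_of_idempotent
    (h.star i i) (h.mul_same i i i)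
  refine ⟨s, hs, F, h1, h2, ?_⟩
  have := h.card_mul_trace i
  rw [← h2, Matrix.trace_mul_comm, h1, Matrix.trace_one] at this
  exact_mod_cast this

lemma card_dvd (h : IsMatrixUnits E) : Fintype.card κ ∣ Fintype.card l := by
  rcases isEmpty_or_nonempty κ with hκ | ⟨⟨i⟩⟩
  -- With no units at all the diagonal sum is empty, which forces `1 = 0` and hence `l` empty.
  · have : (1 : Matrix l l ℂ) = 0 := by rw [← h.sum]; simp
    have := congrArg Matrix.trace this
    rw [Matrix.trace_one, Matrix.trace_zero] at this
    simp [show Fintype.card l = 0 from by exact_mod_cast this]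
  · obtain ⟨s, hs, F, -, -, h3⟩ := h.exists_isometry i
    exact ⟨_, h3.symm⟩

/-- The relative commutant of matrix units of size `k` in a matrix algebra of size `l`
contains matrix units of each size `m` with `k * m ∣ l`. -/
lemma exists_commuting (h : IsMatrixUnits E) [Nonempty κ] {ι : Type*} [Fintype ι] [DecidableEq ι]
    (hι : Fintype.card κ * Fintype.card ι ∣ Fintype.card l) :
    ∃ u : ι → ι → Matrix l l ℂ, IsMatrixUnits u ∧ ∀ i j a b, Commute (E i j) (u a b) := by
  classical
  obtain ⟨o⟩ := ‹Nonempty κ›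
  obtain ⟨s, hs, F, h1, h2, h3⟩ := h.exists_isometry o
  rw [← h3] at hι
  obtain ⟨t, ht⟩ := Nat.dvd_of_mul_dvd_mul_left (Fintype.card_pos_iff.2 ⟨o⟩) hι
  -- The corner at `o` is `M_s ≅ M_ι ⊗ M_t`, so it contains a unital copy `X` of `M_ι`.
  have e : s ≃ ι × Fin t := Fintype.equivOfCardEq (by simp [ht])
  obtain ⟨X, hX⟩ : ∃ X : ι → ι → Matrix s s ℂ, IsMatrixUnits X :=
    ⟨_, ((single s).reindex e.symm).sum_snd⟩
  have hF (Y Z : Matrix s s ℂ) :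
      F * Y * F.conjTranspose * (F * Z * F.conjTranspose) = F * (Y * Z) * F.conjTranspose := by
    calc _ = F * Y * (F.conjTranspose * F) * Z * F.conjTranspose := by
          simp only [Matrix.mul_assoc]
      _ = _ := by rw [h1]; simp only [Matrix.mul_assoc, Matrix.one_mul]
  -- An element of the corner is copied to every diagonal block by the `E i o`; this identifies the
  -- corner with the commutant of the `E i j`.
  let u (b c : ι) : Matrix l l ℂ := ∑ i, E i o * (F * X b c * F.conjTranspose) * E o i
  have hmul (b c : ι) (i j : κ) : E i j * u b c = E i o * (F * X b c * F.conjTranspose) * E o j := by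
    simp only [u, Finset.mul_sum, ← mul_assoc, h.mul]
    simp [ite_mul]
  refine ⟨u, ⟨fun a b c d => ?_, fun a b => ?_, ?_⟩, fun i j a b => ?_⟩
  · have : ∀ i, E i o * (F * X a b * F.conjTranspose) * E o i * u c d
        = if b = c then E i o * (F * X a d * F.conjTranspose) * E o i else 0 := fun i => by
      have hEF : E o o * (F * X c d * F.conjTranspose) = F * X c d * F.conjTranspose := by
        rw [← h2]
        calc _ = F * (F.conjTranspose * F) * X c d * F.conjTranspose := by
              simp only [Matrix.mul_assoc]
          _ = _ := by rw [h1, Matrix.mul_one]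
      rw [mul_assoc _ (E o i), hmul, hEF, ← mul_assoc, mul_assoc (E i o), hF, hX.mul]
      split_ifs <;> simp
    change (∑ i, _) * _ = _
    rw [Finset.sum_mul, Finset.sum_congr rfl fun i _ => this i]
    split_ifs <;> simp [u]
  · simp only [u, star_sum, star_mul, h.star]
    refine Finset.sum_congr rfl fun i _ => ?_
    rw [← hX.star a b, mul_assoc]
    simp [Matrix.star_eq_conjTranspose, Matrix.mul_assoc]
  · have : ∑ b, u b b = ∑ i, E i o * (F * (∑ b, X b b) * F.conjTranspose) * E o i := by
      simp only [u, Matrix.mul_sum, Matrix.sum_mul]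
      exact Finset.sum_comm
    rw [this, hX.sum, Matrix.mul_one, h2]
    simp [h.mul_same, h.sum]
  · change _ * _ = _ * _
    rw [hmul]
    simp only [u, Finset.sum_mul, mul_assoc, h.mul]
    simp [mul_ite]

end IsMatrixUnits

/-! ### Commuting matrix units in UHF algebras -/

namespace UHF.Presentation

variable {D : Type*} [CStarAlgebra D] (P : Presentation D)

/-- Matrix units of the `j`-th subalgebra, as elements of a larger one. -/
lemma exists_units_le {j j' : ℕ} (h : j ≤ j') :
    ∃ E : Fin (P.size j) → Fin (P.size j) → P.sub j', IsMatrixUnits E ∧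
      ∀ x : D, ∀ y : P.sub j', (∀ a b, Commute (E a b) y) → x ∈ P.sub j → Commute x y := by
  obtain ⟨e⟩ := P.iso j
  let f : Matrix (Fin (P.size j)) (Fin (P.size j)) ℂ →⋆ₐ[ℂ] P.sub j' :=
    (StarSubalgebra.inclusion (P.mono h)).comp e.symm.toStarAlgHom
  refine ⟨_, (IsMatrixUnits.single _).map f, fun x y hy hx => ?_⟩
  have hx' : (⟨x, P.mono h hx⟩ : P.sub j') = f (e ⟨x, hx⟩) := by
    apply Subtype.ext
    change x = ((e.symm (e ⟨x, hx⟩) : P.sub j) : D)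
    rw [e.symm_apply_apply]
  have hc : Commute (⟨x, P.mono h hx⟩ : P.sub j') y := by
    rw [hx', Matrix.matrix_eq_sum_single (e ⟨x, hx⟩), map_sum]
    refine Commute.sum_left _ _ _ fun a _ => ?_
    rw [map_sum]
    refine Commute.sum_left _ _ _ fun b _ => ?_
    have : (Matrix.single a b (e ⟨x, hx⟩ a b) : Matrix (Fin (P.size j)) (Fin (P.size j)) ℂ)
        = (e ⟨x, hx⟩ a b) • Matrix.single a b 1 := by simp
    rw [this, map_smul]
    exact (hy a b).smul_left _
  exact congrArg Subtype.val hc.eq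

lemma size_dvd {j j' : ℕ} (h : j ≤ j') : P.size j ∣ P.size j' := by
  obtain ⟨E, hE, -⟩ := P.exists_units_le h
  obtain ⟨e⟩ := P.iso j'
  simpa using (hE.map e).card_dvd

/-- The valuations of the sizes are unbounded and each size divides the later ones, so some quotient
of a later size by `P.size j` is divisible by `p ^ N`. -/
lemma exists_size_dvd {p : ℕ} [Fact p.Prime] (hp : P.supernatural p = ⊤) (j N : ℕ) :
    ∃ j', j ≤ j' ∧ P.size j * p ^ N ∣ P.size j' := by
  obtain ⟨i, hi⟩ : ∃ i, padicValNat p (P.size j) + N ≤ padicValNat p (P.size i) := by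
    by_contra! hcon
    have : P.supernatural p ≤ ((padicValNat p (P.size j) + N : ℕ) : ℕ∞) :=
      iSup_le fun i => by exact_mod_cast (hcon i).le
    rw [hp, top_le_iff] at this
    exact ENat.natCast_ne_top _ this
  obtain ⟨r, hr⟩ := P.size_dvd (le_max_left j i)
  have hsize (k : ℕ) : P.size k ≠ 0 := (P.size_pos k).ne'
  have hr0 : r ≠ 0 := by rintro rfl; exact hsize (max j i) (by rw [hr, mul_zero])
  refine ⟨max j i, le_max_left _ _, ?_⟩
  rw [hr]
  refine Nat.mul_dvd_mul_left _ ((padicValNat_dvd_iff_le hr0).2 ?_)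
  have h1 : padicValNat p (P.size i) ≤ padicValNat p (P.size (max j i)) :=
    (padicValNat_dvd_iff_le (hsize _)).1 (pow_padicValNat_dvd.trans (P.size_dvd (le_max_right j i)))
  rw [hr, padicValNat.mul (hsize j) hr0] at h1
  omega

/-- The commutant of `A_j` in `A_{j'}` has size `k_{j'} / k_j`, and `j'` is chosen so that `p ^ N`
divides it. -/
lemma exists_commuting_units {p : ℕ} [Fact p.Prime] (hp : P.supernatural p = ⊤) (j N : ℕ) :
    ∃ j', j ≤ j' ∧ ∃ u : ZMod (p ^ N) → ZMod (p ^ N) → D, IsMatrixUnits u ∧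
      (∀ a b, u a b ∈ P.sub j') ∧ ∀ a b, ∀ x ∈ P.sub j, Commute x (u a b) := by
  obtain ⟨j', hj, hdvd⟩ := P.exists_size_dvd hp j N
  obtain ⟨E, hE, hcomm⟩ := P.exists_units_le hj
  obtain ⟨e⟩ := P.iso j'
  have : Nonempty (Fin (P.size j)) := ⟨⟨0, P.size_pos j⟩⟩
  obtain ⟨u, hu, hEu⟩ := (hE.map e).exists_commuting (ι := ZMod (p ^ N))
    (by simpa [ZMod.card] using hdvd)
  refine ⟨j', hj, fun a b => e.symm (u a b), (hu.map e.symm).map (P.sub j').subtype,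
    fun a b => (e.symm (u a b)).2, fun a b x hx => hcomm x _ (fun c d => ?_) hx⟩
  have := (hEu c d a b).map e.symm
  rwa [e.symm_apply_apply] at this

/-- If `p` has infinite exponent, there is a sequence of mutually commuting systems of matrix
units of size `p ^ N`. -/
lemma exists_commuting_sequence {p : ℕ} [Fact p.Prime] (hp : P.supernatural p = ⊤) (N : ℕ) :
    ∃ u : ℕ → ZMod (p ^ N) → ZMod (p ^ N) → D, (∀ i, IsMatrixUnits (u i)) ∧
      ∀ i i', i ≠ i' → ∀ a b c d, Commute (u i a b) (u i' c d) := by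
  choose next hnext u hu hmem hcomm using fun j => P.exists_commuting_units hp j N
  -- The `i`-th system commutes with the subalgebra of index `J i` and lies in the one of index `J
  -- (i + 1)`, so every later system commutes with it.
  let J : ℕ → ℕ := fun i => next^[i] 0
  have hJ (i : ℕ) : J (i + 1) = next (J i) := Function.iterate_succ_apply' _ _ _
  have hmono : Monotone J := monotone_nat_of_le_succ fun i => by rw [hJ]; exact hnext _
  have key (i i' : ℕ) (h : i < i') (a b c d) : Commute (u (J i) a b) (u (J i') c d) := by
    refine hcomm _ _ _ _ (P.mono (hmono h) ?_)
    rw [Nat.succ_eq_add_one, hJ]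
    exact hmem _ _ _
  refine ⟨fun i => u (J i), fun i => hu _, fun i i' h a b c d => ?_⟩
  rcases h.lt_or_gt with h | h
  · exact key _ _ h _ _ _ _
  · exact (key _ _ h _ _ _ _).symm

lemma nontrivial (P : Presentation D) : Nontrivial D := by
  obtain ⟨e⟩ := P.iso 0
  have : Nonempty (Fin (P.size 0)) := ⟨⟨0, P.size_pos 0⟩⟩
  have : Nontrivial (P.sub 0) := e.toEquiv.nontrivial
  exact (Subtype.val_injective (p := (· ∈ P.sub 0))).nontrivial

end UHF.Presentation

/-! ### Embedding `M_{p^∞}` by commuting `p × p` matrix units -/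

namespace UHF

/-- The reindexing of a sum over `p ^ (j + 1)` by the leading digit and the others. -/
lemma sum_fin_pow_succ {p : ℕ} {M : Type*} [AddCommMonoid M] (j : ℕ) (f : ℕ → M) :
    ∑ x : Fin (p ^ (j + 1)), f x
      = ∑ k : Fin p, ∑ s : Fin (p ^ j), f (finProdFinEquiv (k, s) : Fin (p * p ^ j)) := by
  rw [← Fintype.sum_prod_type', finProdFinEquiv.sum_comp fun x : Fin (p * p ^ j) => f x,
    Fin.sum_univ_eq_sum_range f, Fin.sum_univ_eq_sum_range f, pow_succ']

variable {F : Type*} [CStarAlgebra F] {p : ℕ} [NeZero p]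

/-- The products of matrix units `E₀, …, E_{j-1}`, indexed by the base `p` digits of numbers. -/
def digitUnits (E : ℕ → Fin p → Fin p → F) : ℕ → ℕ → ℕ → F
  | 0, _, _ => 1
  | j + 1, x, y => E j (Fin.ofNat p (x / p ^ j)) (Fin.ofNat p (y / p ^ j)) * digitUnits E j x y

variable {E : ℕ → Fin p → Fin p → F}

lemma commute_digitUnits (hE : ∀ i i', i ≠ i' → ∀ a b c d, Commute (E i a b) (E i' c d))
    {i j : ℕ} (h : j ≤ i) (a b : Fin p) (x y : ℕ) : Commute (E i a b) (digitUnits E j x y) := by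
  induction j with
  | zero => exact Commute.one_right _
  | succ j ih => exact (hE i j (by omega) _ _ _ _).mul_right (ih (by omega))

/-- Only the `j` lowest digits enter. Indexing by all of `ℕ` avoids transport between `Fin (p ^ (j +
1))` and `Fin (p * p ^ j)`. -/
lemma digitUnits_mod (j x y : ℕ) :
    digitUnits E j (x % p ^ j) (y % p ^ j) = digitUnits E j x y := by
  -- The modulus `p ^ k` stays fixed while the induction runs over the number of digits.
  suffices h : ∀ k j, j ≤ k → digitUnits E j (x % p ^ k) (y % p ^ k) = digitUnits E j x y from
    h j j le_rfl
  intro k j hj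
  induction j with
  | zero => rfl
  | succ j ih =>
    have hd (z : ℕ) : Fin.ofNat p (z % p ^ k / p ^ j) = Fin.ofNat p (z / p ^ j) := by
      obtain ⟨t, rfl⟩ := Nat.exists_eq_add_of_le hj
      rw [show p ^ (j + 1 + t) = p ^ j * (p * p ^ t) by ring, Nat.mod_mul_right_div_self]
      simp [Fin.ofNat]
    rw [digitUnits, digitUnits, hd, hd, ih (by omega)]

lemma mod_pow_succ_eq_iff (j x y : ℕ) : x % p ^ (j + 1) = y % p ^ (j + 1) ↔
    Fin.ofNat p (x / p ^ j) = Fin.ofNat p (y / p ^ j) ∧ x % p ^ j = y % p ^ j := by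
  have h (z : ℕ) : z % p ^ (j + 1) = z % p ^ j + p ^ j * (z / p ^ j % p) := by
    rw [pow_succ, Nat.mod_mul]
  have hlt (z : ℕ) : z % p ^ j < p ^ j := Nat.mod_lt _ (NeZero.pos _)
  have hdiv (z : ℕ) : z % p ^ (j + 1) / p ^ j = z / p ^ j % p := by
    rw [pow_succ, Nat.mod_mul_right_div_self]
  have hmod (z : ℕ) : z % p ^ (j + 1) % p ^ j = z % p ^ j := by
    rw [pow_succ, Nat.mod_mul_right_mod]
  simp only [Fin.ext_iff, Fin.ofNat]
  constructor
  · intro e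
    rw [← hdiv, ← hdiv, ← hmod x, ← hmod y, e]
    exact ⟨rfl, rfl⟩
  · rintro ⟨e1, e2⟩
    rw [h, h, e1, e2]

lemma digitUnits_mul (hu : ∀ i, IsMatrixUnits (E i))
    (hE : ∀ i i', i ≠ i' → ∀ a b c d, Commute (E i a b) (E i' c d)) (j x y z w : ℕ) :
    digitUnits E j x y * digitUnits E j z w
      = if y % p ^ j = z % p ^ j then digitUnits E j x w else 0 := by
  induction j with
  | zero => simp [digitUnits, Nat.mod_one]
  | succ j ih =>
    simp only [mod_pow_succ_eq_iff]
    rw [digitUnits, digitUnits, mul_assoc, ← mul_assoc (digitUnits E j x y),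
      ← (commute_digitUnits hE le_rfl _ _ _ _).eq, mul_assoc, ih, ← mul_assoc, (hu j).mul, ite_and]
    split_ifs <;> simp [digitUnits]

lemma star_digitUnits (hu : ∀ i, IsMatrixUnits (E i))
    (hE : ∀ i i', i ≠ i' → ∀ a b c d, Commute (E i a b) (E i' c d)) (j x y : ℕ) :
    star (digitUnits E j x y) = digitUnits E j y x := by
  induction j with
  | zero => simp [digitUnits]
  | succ j ih =>
    rw [digitUnits, star_mul, ih, (hu j).star, digitUnits]
    exact (commute_digitUnits hE le_rfl _ _ _ _).eq.symm

lemma digit_finProdFinEquiv (j : ℕ) (k : Fin p) (s : Fin (p ^ j)) :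
    Fin.ofNat p ((finProdFinEquiv (k, s) : Fin (p * p ^ j)) / p ^ j : ℕ) = k := by
  have hd : 0 < p ^ j := NeZero.pos _
  simp [Nat.add_mul_div_left _ _ hd, Nat.div_eq_of_lt s.2]

lemma digitUnits_finProdFinEquiv (j : ℕ) (k l : Fin p) (s t : Fin (p ^ j)) :
    digitUnits E (j + 1) (finProdFinEquiv (k, s) : Fin (p * p ^ j))
      (finProdFinEquiv (l, t) : Fin (p * p ^ j)) = E j k l * digitUnits E j s t := by
  rw [digitUnits, digit_finProdFinEquiv, digit_finProdFinEquiv, ← digitUnits_mod]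
  simp [Nat.mod_eq_of_lt s.2, Nat.mod_eq_of_lt t.2]

lemma isMatrixUnits_digitUnits (hu : ∀ i, IsMatrixUnits (E i))
    (hE : ∀ i i', i ≠ i' → ∀ a b c d, Commute (E i a b) (E i' c d)) (j : ℕ) :
    IsMatrixUnits fun x y : Fin (p ^ j) => digitUnits E j x y where
  mul x y z w := by
    rw [digitUnits_mul hu hE, Nat.mod_eq_of_lt y.2, Nat.mod_eq_of_lt z.2]
    simp [Fin.ext_iff]
  star x y := star_digitUnits hu hE j x y
  sum := by
    induction j with
    | zero =>
      simp only [digitUnits, Finset.sum_const, Finset.card_univ, Fintype.card_fin, pow_zero,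
        one_smul]
    | succ j ih =>
      rw [sum_fin_pow_succ j fun x => digitUnits E (j + 1) x x]
      simp only [digitUnits_finProdFinEquiv, ← Finset.mul_sum, ih, mul_one, (hu j).sum]

/-- The matrix `1 ⊗ a`, for which `amp (p ^ (j + 1)) (1 ⊗ a) = amp (p ^ j) a`. -/
def ampMatrix {j : ℕ} (a : Matrix (Fin (p ^ j)) (Fin (p ^ j)) ℂ) :
    Matrix (Fin (p ^ (j + 1))) (Fin (p ^ (j + 1))) ℂ :=
  Matrix.of fun x y => if (x : ℕ) / p ^ j = y / p ^ j then
    a (Fin.ofNat (p ^ j) x) (Fin.ofNat (p ^ j) y) else 0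

/-- The connecting maps of `M_{p^∞}` are `a ↦ 1 ⊗ a`. -/
lemma amp_one_tensor {d e N : ℕ} [NeZero d] [NeZero e] [NeZero N] (hN : N = e * d)
    (a : Matrix (Fin d) (Fin d) ℂ) :
    amp N (Matrix.of fun i j : Fin N =>
      if (i : ℕ) / d = j / d then a (Fin.ofNat d i) (Fin.ofNat d j) else 0) = amp d a := by
  subst hN
  ext ξ m
  rw [amp_apply (e * d), amp_apply d, ← finProdFinEquiv.sum_comp, Fintype.sum_prod_type]
  have hd : 0 < d := NeZero.pos d
  have h1 (k : Fin e) (s : Fin d) : ((finProdFinEquiv (k, s) : Fin (e * d)) : ℕ) / d = k := by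
    simp [Nat.add_mul_div_left _ _ hd, Nat.div_eq_of_lt s.2]
  have h2 (k : Fin e) (s : Fin d) : Fin.ofNat d (finProdFinEquiv (k, s) : Fin (e * d)) = s := by
    simp [Fin.ofNat, Nat.mod_eq_of_lt s.2]
  have h3 : Fin.ofNat d (Fin.ofNat (e * d) m) = Fin.ofNat d m := by
    simp [Fin.ofNat]
  have h4 (k : Fin e) :
      ((Fin.ofNat (e * d) m : Fin (e * d)) : ℕ) / d = k ↔ Fin.ofNat e (m / d) = k := by
    simp [Fin.ext_iff, Fin.ofNat, mul_comm e d, Nat.mod_mul_right_div_self]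
  simp only [Matrix.of_apply, h1, h2, h3, h4, ite_mul, zero_mul]
  rw [Finset.sum_comm]
  refine Finset.sum_congr rfl fun s _ => ?_
  rw [Finset.sum_ite_eq]
  simp only [Finset.mem_univ, if_true]
  congr 2
  have h5 : d * (m / d) = e * d * (m / d / e) + d * (m / d % e) := by
    rw [mul_comm e d, mul_assoc, ← mul_add, Nat.div_add_mod]
  simp only [finProdFinEquiv_apply_val, Fin.val_ofNat]
  rw [h5, Nat.div_div_eq_div_mul, mul_comm d e, add_assoc, add_comm (s : ℕ)]

lemma amp_ampMatrix {j : ℕ} (a : Matrix (Fin (p ^ j)) (Fin (p ^ j)) ℂ) :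
    amp (p ^ (j + 1)) (ampMatrix a) = amp (p ^ j) a :=
  amp_one_tensor (pow_succ' p j) a

/-- Summation of a matrix `1 ⊗ a` against the products of matrix units. -/
lemma hom_ampMatrix (hu : ∀ i, IsMatrixUnits (E i))
    (hE : ∀ i i', i ≠ i' → ∀ a b c d, Commute (E i a b) (E i' c d)) (j : ℕ)
    (a : Matrix (Fin (p ^ j)) (Fin (p ^ j)) ℂ) :
    (isMatrixUnits_digitUnits hu hE (j + 1)).hom (ampMatrix a)
      = (isMatrixUnits_digitUnits hu hE j).hom a := by
  have hd : 0 < p ^ j := NeZero.pos _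
  have h1 (k : Fin p) (s : Fin (p ^ j)) :
      ((finProdFinEquiv (k, s) : Fin (p * p ^ j)) : ℕ) / p ^ j = k := by
    simp [Nat.add_mul_div_left _ _ hd, Nat.div_eq_of_lt s.2]
  have h2 (k : Fin p) (s : Fin (p ^ j)) :
      Fin.ofNat (p ^ j) (finProdFinEquiv (k, s) : Fin (p * p ^ j)) = s := by
    simp [Fin.ext_iff, Nat.mod_eq_of_lt s.2]
  let g (x y : ℕ) : ℂ := if x / p ^ j = y / p ^ j then
    a (Fin.ofNat (p ^ j) x) (Fin.ofNat (p ^ j) y) else 0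
  rw [IsMatrixUnits.hom_apply, IsMatrixUnits.hom_apply]
  change ∑ x : Fin (p ^ (j + 1)), ∑ y : Fin (p ^ (j + 1)), g x y • digitUnits E (j + 1) x y = _
  simp only [fun x : ℕ => sum_fin_pow_succ (p := p) j fun y => g x y • digitUnits E (j + 1) x y]
  rw [sum_fin_pow_succ (p := p) j fun x => ∑ k : Fin p, ∑ s : Fin (p ^ j),
    g x (finProdFinEquiv (k, s) : Fin (p * p ^ j)) •
      digitUnits E (j + 1) x (finProdFinEquiv (k, s) : Fin (p * p ^ j))]
  simp only [digitUnits_finProdFinEquiv, g, h1, h2, ite_smul, zero_smul, Fin.val_inj]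
  -- The matrix `1 ⊗ a` is diagonal in the leading digit, so only the units `E j k k` survive, and
  -- these sum to `1`.
  have h3 (k : Fin p) (s : Fin (p ^ j)) : (∑ l : Fin p, ∑ t : Fin (p ^ j),
      if k = l then a s t • (E j k l * digitUnits E j s t) else 0)
        = E j k k * ∑ t, a s t • digitUnits E j s t := by
    rw [Finset.sum_comm, Finset.mul_sum]
    refine Finset.sum_congr rfl fun t _ => ?_
    simp
  simp only [h3, ← Finset.mul_sum, ← Finset.sum_mul, (hu j).sum, one_mul]

/-- A compatible family of unital `⋆`-homomorphisms of the matrix algebras `M_{p^j}` extends to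
an injective unital `⋆`-homomorphism of `M_{p^∞}`. -/
lemma exists_mInfty_hom [Nontrivial F]
    (ψ : ∀ j, Matrix (Fin (p ^ j)) (Fin (p ^ j)) ℂ →⋆ₐ[ℂ] F)
    (hψ : ∀ j a, ψ (j + 1) (ampMatrix a) = ψ j a) :
    ∃ φ : mInfty p →⋆ₐ[ℂ] F, Function.Injective φ := by
  have hne (j : ℕ) : Nonempty (Fin (p ^ j)) := ⟨⟨0, NeZero.pos _⟩⟩
  -- Matrix algebras are simple and `F` is nonzero.
  have hinj (j : ℕ) : Function.Injective (ψ j) :=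
    (ψ j : Matrix (Fin (p ^ j)) (Fin (p ^ j)) ℂ →+* F).injective
  -- `Γ j` is the graph of `amp a ↦ ψ a`. Both coordinates are isometric on the closure `G` of the
  -- union, so `G` is the graph of the required embedding; this replaces an extension by continuity.
  let Γ (j : ℕ) : StarSubalgebra ℂ ((Hilb →L[ℂ] Hilb) × F) := ((amp (p ^ j)).prod (ψ j)).range
  have hmono : Monotone Γ := monotone_nat_of_le_succ fun j => by
    rintro _ ⟨a, rfl⟩
    refine ⟨ampMatrix a, Prod.ext (amp_ampMatrix a) (hψ j a)⟩
  let G := (⨆ j, Γ j).topologicalClosure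
  have hG : IsClosed (G : Set ((Hilb →L[ℂ] Hilb) × F)) :=
    StarSubalgebra.isClosed_topologicalClosure _
  have hGind (S : Set ((Hilb →L[ℂ] Hilb) × F)) (hS : IsClosed S)
      (h : ∀ j a, (amp (p ^ j) a, ψ j a) ∈ S) : (G : Set _) ⊆ S := by
    refine closure_minimal ?_ hS
    rw [StarSubalgebra.coe_iSup_of_directed hmono.directed_le]
    refine Set.iUnion_subset fun j => ?_
    rintro _ ⟨a, rfl⟩
    exact h j a
  -- Injective `⋆`-homomorphisms of C⋆-algebras are isometric, and equality of norms passes to the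
  -- closure.
  have hnorm : ∀ x ∈ G, ‖x.1‖ = ‖x.2‖ := by
    refine hGind {x | ‖x.1‖ = ‖x.2‖} (isClosed_eq (by fun_prop) (by fun_prop)) fun j a => ?_
    let _ : CStarAlgebra (Matrix (Fin (p ^ j)) (Fin (p ^ j)) ℂ) := Matrix.instCStarAlgebra
    change ‖amp (p ^ j) a‖ = ‖ψ j a‖
    exact (NonUnitalStarAlgHom.norm_map (amp (p ^ j)) (amp_injective _) a).trans
      (NonUnitalStarAlgHom.norm_map (ψ j) (hinj j) a).symm
  have hmem : ∀ x ∈ G, x.1 ∈ mInfty p := by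
    refine hGind {x | x.1 ∈ mInfty p}
      ((StarSubalgebra.isClosed_topologicalClosure _).preimage continuous_fst) fun j a => ?_
    exact StarSubalgebra.le_topologicalClosure _
      ((le_iSup (fun j : ℕ => (amp (p ^ j)).range) j) ⟨a, rfl⟩)
  let π₁ : G →⋆ₐ[ℂ] mInfty p := ((StarAlgHom.fst ℂ _ _).comp G.subtype).codRestrict (mInfty p)
    fun x => hmem x x.2
  let π₂ : G →⋆ₐ[ℂ] F := (StarAlgHom.snd ℂ _ _).comp G.subtype
  have hπ (x : G) : ‖π₁ x‖ = ‖π₂ x‖ := hnorm x x.2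
  have hxn (x : G) : ‖π₁ x‖ = ‖x‖ := by
    change ‖(x : (Hilb →L[ℂ] Hilb) × F).1‖ = ‖(x : (Hilb →L[ℂ] Hilb) × F)‖
    rw [Prod.norm_def, ← hnorm x x.2, max_self]
  have hiso : Isometry π₁ := AddMonoidHomClass.isometry_of_norm π₁ hxn
  have : CompleteSpace G := hG.completeSpace_coe
  have hclosed : IsClosed (Set.range π₁) := hiso.isClosedEmbedding.isClosed_range
  have hsurj : Function.Surjective π₁ := by
    -- The range is closed, by completeness of `G`, and contains the dense union of the matrix
    -- algebras.
    rw [← Set.range_eq_univ, ← hclosed.closure_eq, ← dense_iff_closure_eq]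
    refine (mInftyPresentation p).dense.mono (Set.iUnion_subset fun j => ?_)
    rintro x ⟨a, ha⟩
    exact ⟨⟨(amp (p ^ j) a, ψ j a), StarSubalgebra.le_topologicalClosure _
      ((le_iSup Γ j) ⟨a, rfl⟩)⟩, Subtype.ext ha⟩
  let e := StarAlgEquiv.ofBijective π₁ ⟨hiso.injective, hsurj⟩
  refine ⟨π₂.comp e.symm.toStarAlgHom, ?_⟩
  rw [injective_iff_map_eq_zero]
  intro x hx
  have h1 : ‖π₁ (e.symm x)‖ = 0 := by rw [hπ]; exact norm_eq_zero.2 hx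
  have h2 : π₁ (e.symm x) = x := e.apply_symm_apply x
  rwa [h2, norm_eq_zero] at h1

/-- Mutually commuting sequences of `p × p` matrix units in a closed unital `⋆`-subalgebra define
an embedding of `M_{p^∞}`. -/
lemma exists_mInfty_hom_of_mem [Nontrivial F] {S : StarSubalgebra ℂ F}
    (hS : IsClosed (S : Set F)) (hu : ∀ i, IsMatrixUnits (E i))
    (hE : ∀ i i', i ≠ i' → ∀ a b c d, Commute (E i a b) (E i' c d))
    (hmem : ∀ i a b, E i a b ∈ S) : ∃ φ : mInfty p →⋆ₐ[ℂ] S, Function.Injective φ := by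
  let _ : CStarAlgebra S := StarSubalgebra.cstarAlgebra S (h_closed := hS)
  have hu' (i : ℕ) := (hu i).codRestrict S (hmem i)
  have hE' : ∀ i i', i ≠ i' → ∀ a b c d,
      Commute (⟨E i a b, hmem i a b⟩ : S) ⟨E i' c d, hmem i' c d⟩ :=
    fun i i' h a b c d => Subtype.ext (hE i i' h a b c d).eq
  exact exists_mInfty_hom (fun j => (isMatrixUnits_digitUnits hu' hE' j).hom)
    (hom_ampMatrix hu' hE')

end UHF

/-! ### States and Hilbert space representations -/

/-- A functional of norm one at the unit is positive. -/
lemma CStarAlgebra.exists_state (A : Type*) [CStarAlgebra A] [PartialOrder A] [StarOrderedRing A]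
    [Nontrivial A] : ∃ f : A →ₚ[ℂ] ℂ, f 1 = 1 := by
  -- By Hahn–Banach there is a functional with `‖g‖ = 1 = g 1`.
  obtain ⟨g, hg, hg1⟩ := exists_dual_vector ℂ (1 : A) (by simp)
  rw [CStarRing.norm_one, RCLike.ofReal_one] at hg1
  have hle (x : A) : ‖g x‖ ≤ ‖x‖ := by simpa [hg] using g.le_opNorm x
  have him (a : A) (ha : IsSelfAdjoint a) : (g a).im = 0 := by
    -- Compare `|g (a + it)|²` with `‖a + it‖² ≤ ‖a‖² + t²`: the left side contains a term linear in
    -- `t` unless `g a` is real.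
    have key (t : ℝ) : ((g a).im + t) ^ 2 ≤ ‖a‖ ^ 2 + t ^ 2 := by
      have h1 := hle (a + (t * Complex.I : ℂ) • 1)
      have h2 : ‖a + (t * Complex.I : ℂ) • (1 : A)‖ ^ 2 ≤ ‖a‖ ^ 2 + t ^ 2 := by
        rw [sq, ← CStarRing.norm_star_mul_self]
        have e : star (a + (t * Complex.I : ℂ) • (1 : A)) * (a + (t * Complex.I : ℂ) • 1)
            = a * a + ((t : ℂ) ^ 2) • (1 : A) := by
          simp only [star_add, ha.star_eq, star_smul, star_one, add_mul, mul_add, smul_mul_assoc,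
            mul_smul_comm, one_mul, mul_one]
          simp only [star_mul', RCLike.star_def, Complex.conj_ofReal, Complex.conj_I]
          match_scalars <;> (ring_nf; try simp)
        rw [e]
        refine (norm_add_le _ _).trans ?_
        rw [norm_smul, CStarRing.norm_one, mul_one, norm_pow, Complex.norm_real, Real.norm_eq_abs,
          sq_abs, sq ‖a‖]
        exact add_le_add (norm_mul_le _ _) le_rfl
      have h3 : ((g a).im + t) ^ 2 ≤ ‖g (a + (t * Complex.I : ℂ) • (1 : A))‖ ^ 2 := by
        rw [map_add, map_smul, hg1, Complex.sq_norm, Complex.normSq_apply]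
        simp
        nlinarith [sq_nonneg (g a).re]
      exact h3.trans ((pow_le_pow_left₀ (norm_nonneg _) h1 2).trans h2)
    by_contra hne
    -- This `t` makes the cross term equal to `‖a‖ ^ 2 + 1`, which exceeds the bound.
    have := key ((‖a‖ ^ 2 + 1) / (2 * (g a).im))
    have e : 2 * (g a).im * ((‖a‖ ^ 2 + 1) / (2 * (g a).im)) = ‖a‖ ^ 2 + 1 := by
      field_simp
    nlinarith [sq_nonneg (g a).im]
  have hnonneg (a : A) (ha : 0 ≤ a) : 0 ≤ g a := by
    have hi := him a ha.isSelfAdjoint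
    rw [Complex.nonneg_iff]
    refine ⟨?_, hi.symm⟩
    -- Since `0 ≤ ‖a‖ - a ≤ ‖a‖`, applying `g` gives `‖a‖ - re (g a) ≤ ‖a‖`.
    have h1 : ‖algebraMap ℝ A ‖a‖ - a‖ ≤ ‖a‖ := by
      have h2 : 0 ≤ algebraMap ℝ A ‖a‖ - a :=
        sub_nonneg.2 (IsSelfAdjoint.le_algebraMap_norm_self ha.isSelfAdjoint)
      rw [CStarAlgebra.norm_le_iff_le_algebraMap _ (norm_nonneg a) h2]
      exact sub_le_self _ ha
    have h2 := (Complex.re_le_norm _).trans ((hle _).trans h1)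
    have h3 : (algebraMap ℝ A ‖a‖ : A) = (‖a‖ : ℂ) • (1 : A) := by
      rw [Algebra.algebraMap_eq_smul_one, Complex.coe_smul]
    rw [map_sub, h3, map_smul, hg1] at h2
    simp at h2
    exact h2
  exact ⟨PositiveLinearMap.mk₀ (g : A →ₗ[ℂ] ℂ) hnonneg, hg1⟩

/-- A nontrivial unital C⋆-algebra has a unital representation on a nontrivial Hilbert space. -/
lemma CStarAlgebra.exists_representation (A : Type u) [CStarAlgebra A] [Nontrivial A] :
    ∃ (H : Type u) (_ : NormedAddCommGroup H) (_ : InnerProductSpace ℂ H) (_ : Nontrivial H)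
      (π : A →ₐ[ℂ] Module.End ℂ H), ∀ a v w, inner ℂ (π a v) w = inner ℂ v (π (star a) w) := by
  let _ := CStarAlgebra.spectralOrder A
  let _ := CStarAlgebra.spectralOrderedRing A
  obtain ⟨f, hf⟩ := CStarAlgebra.exists_state A
  -- The operators are kept as plain linear maps with an adjointness identity, because the tensor
  -- products formed later are algebraic and need not be complete.
  let π : A →ₐ[ℂ] Module.End ℂ f.GNS :=
    { toFun := fun a => (f.gnsStarAlgHom a : f.GNS →ₗ[ℂ] f.GNS)
      map_one' := by rw [map_one]; rfl
      map_mul' := fun a b => by rw [map_mul]; rfl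
      map_zero' := by rw [map_zero]; rfl
      map_add' := fun a b => by rw [map_add]; rfl
      commutes' := fun c => by rw [AlgHomClass.commutes]; rfl }
  refine ⟨f.GNS, inferInstance, inferInstance, ?_, π, fun a v w => ?_⟩
  · refine ⟨((f.toPreGNS 1 : f.PreGNS) : f.GNS), 0, fun h => ?_⟩
    have h1 : ‖((f.toPreGNS 1 : f.PreGNS) : f.GNS)‖ = 0 := by rw [h, norm_zero]
    rw [UniformSpace.Completion.norm_coe] at h1
    have h2 := f.preGNS_norm_sq (f.toPreGNS 1)
    rw [h1] at h2
    simp [hf] at h2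
  · change inner ℂ (f.gnsStarAlgHom a v) w = inner ℂ v (f.gnsStarAlgHom (star a) w)
    rw [map_star, ContinuousLinearMap.star_eq_adjoint, ContinuousLinearMap.adjoint_inner_right]

/-- A `⋆`-representation of a C⋆-algebra on an inner product space is contractive. -/
lemma CStarAlgebra.norm_representation_le {A V : Type*} [CStarAlgebra A] [NormedAddCommGroup V]
    [InnerProductSpace ℂ V] (π : A →ₐ[ℂ] Module.End ℂ V)
    (h : ∀ a v w, inner ℂ (π a v) w = inner ℂ v (π (star a) w)) (a : A) (v : V) :
    ‖π a v‖ ≤ ‖a‖ * ‖v‖ := by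
  let _ := CStarAlgebra.spectralOrder A
  let _ := CStarAlgebra.spectralOrderedRing A
  have hsq (b : A) : ((‖π b v‖ : ℂ)) ^ 2 = inner ℂ v (π (star b * b) v) := by
    rw [map_mul, Module.End.mul_apply, ← h, inner_self_eq_norm_sq_to_K]
    rfl
  have hpos : 0 ≤ algebraMap ℝ A (‖a‖ ^ 2) - star a * a := by
    have := IsSelfAdjoint.le_algebraMap_norm_self (IsSelfAdjoint.star_mul_self a)
    rw [CStarRing.norm_star_mul_self, ← sq] at this
    exact sub_nonneg.2 this
  -- With `s⋆ s = ‖a‖² - a⋆ a`, the number `‖π s v‖² = ‖a‖² ‖v‖² - ‖π a v‖²` is nonnegative.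
  obtain ⟨s, hs⟩ := CStarAlgebra.nonneg_iff_eq_star_mul_self.1 hpos
  have key := hsq s
  have h3 : (algebraMap ℝ A (‖a‖ ^ 2) : A) = ((‖a‖ : ℂ) ^ 2) • (1 : A) := by
    rw [Algebra.algebraMap_eq_smul_one, ← Complex.ofReal_pow, Complex.coe_smul]
  rw [← hs, h3, map_sub, map_smul, map_one, LinearMap.sub_apply, inner_sub_right, ← hsq a,
    LinearMap.smul_apply, Module.End.one_apply, inner_smul_right, inner_self_eq_norm_sq_to_K] at key
  have key' : ‖π s v‖ ^ 2 = ‖a‖ ^ 2 * ‖v‖ ^ 2 - ‖π a v‖ ^ 2 := by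
    apply Complex.ofReal_injective
    push_cast
    exact key
  have : ‖π a v‖ ^ 2 ≤ (‖a‖ * ‖v‖) ^ 2 := by
    rw [mul_pow]; nlinarith [sq_nonneg ‖π s v‖]
  exact (sq_le_sq₀ (norm_nonneg _) (by positivity)).1 this

/-! ### Representations of algebraic tensor powers -/

/-- An algebraic `⋆`-representation of the tensor power of a C⋆-algebra on an inner product
space. -/
structure PowerRepresentation (A : Type*) [CStarAlgebra A] (n : ℕ) (V : Type*)
    [NormedAddCommGroup V] [InnerProductSpace ℂ V] where
  /-- the image of an elementary tensor -/
  map : MultilinearMap ℂ (fun _ : Fin n => A) (Module.End ℂ V)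
  map_one : map 1 = 1
  map_mul : ∀ a b, map (a * b) = map a * map b
  inner_left : ∀ a v w, inner ℂ (map a v) w = inner ℂ v (map (star a) w)

namespace PowerRepresentation

open TensorProduct

section

variable {A : Type*} [CStarAlgebra A] {n : ℕ} {V H : Type*} [NormedAddCommGroup V]
  [InnerProductSpace ℂ V] [NormedAddCommGroup H] [InnerProductSpace ℂ H]

/-- The multilinear map `(a₀, …, aₙ) ↦ π a₀ ⊗ f (a₁, …, aₙ)`. -/
def consMap (π : A →ₐ[ℂ] Module.End ℂ H)
    (f : MultilinearMap ℂ (fun _ : Fin n => A) (Module.End ℂ V)) :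
    MultilinearMap ℂ (fun _ : Fin (n + 1) => A) (Module.End ℂ (H ⊗[ℂ] V)) :=
  LinearMap.uncurryLeft
    { toFun := fun a => (mapBilinear (.id ℂ) H V H V (π a)).compMultilinearMap f
      map_add' := fun a b => by ext : 1; simp
      map_smul' := fun c a => by ext : 1; simp }

lemma consMap_tmul (π : A →ₐ[ℂ] Module.End ℂ H)
    (f : MultilinearMap ℂ (fun _ : Fin n => A) (Module.End ℂ V)) (a : Fin (n + 1) → A)
    (x : H) (y : V) : consMap π f a (x ⊗ₜ y) = π (a 0) x ⊗ₜ f (Fin.tail a) y := rfl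

/-- Tensoring with one more representation. -/
def cons (R : PowerRepresentation A n V) (π : A →ₐ[ℂ] Module.End ℂ H)
    (h : ∀ a v w, inner ℂ (π a v) w = inner ℂ v (π (star a) w)) :
    PowerRepresentation A (n + 1) (H ⊗[ℂ] V) where
  map := consMap π R.map
  map_one := by
    refine TensorProduct.ext' fun x y => ?_
    have e : Fin.tail (1 : Fin (n + 1) → A) = 1 := rfl
    rw [consMap_tmul, e, R.map_one, Pi.one_apply, _root_.map_one]
    rfl
  map_mul a b := by
    refine TensorProduct.ext' fun x y => ?_
    have e : Fin.tail (a * b) = Fin.tail a * Fin.tail b := rfl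
    rw [Module.End.mul_apply, consMap_tmul, consMap_tmul, consMap_tmul, e, R.map_mul,
      Pi.mul_apply, _root_.map_mul]
    rfl
  inner_left a v w := by
    have e : Fin.tail (star a) = star (Fin.tail a) := rfl
    induction v using TensorProduct.induction_on with
    | zero => rw [map_zero, inner_zero_left, inner_zero_left]
    | add v v' hv hv' => rw [map_add, inner_add_left, hv, hv', inner_add_left]
    | tmul x y =>
      induction w using TensorProduct.induction_on with
      | zero => rw [map_zero, inner_zero_right, inner_zero_right]
      | add w w' hw hw' => rw [map_add, inner_add_right, hw, hw', inner_add_right]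
      | tmul x' y' =>
        rw [consMap_tmul, consMap_tmul, inner_tmul, inner_tmul, h, R.inner_left, e, Pi.star_apply]

end

lemma exists_nontrivial (A : Type u) [CStarAlgebra A] [Nontrivial A] (n : ℕ) :
    ∃ (V : Type u) (_ : NormedAddCommGroup V) (_ : InnerProductSpace ℂ V) (_ : Nontrivial V),
      Nonempty (PowerRepresentation A n V) := by
  obtain ⟨H, _, _, _, π, hπ⟩ := CStarAlgebra.exists_representation A
  induction n with
  -- The empty tensor power is `ℂ`, acting on `H` by scalars.
  | zero => exact ⟨H, _, _, ‹_›, ⟨⟨.constOfIsEmpty ℂ _ 1, rfl, fun a b => (mul_one _).symm,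
      fun a v w => rfl⟩⟩⟩
  | succ n ih =>
    obtain ⟨V, _, _, _, ⟨R⟩⟩ := ih
    refine ⟨TensorProduct ℂ H V, _, inferInstance, ?_, ⟨R.cons π hπ⟩⟩
    obtain ⟨x, hx⟩ := exists_ne (0 : H)
    obtain ⟨y, hy⟩ := exists_ne (0 : V)
    refine ⟨TensorProduct.tmul ℂ x y, 0, fun h0 => ?_⟩
    have := TensorProduct.norm_tmul (𝕜 := ℂ) x y
    rw [h0, norm_zero] at this
    simp [hx, hy] at this

open CStarTensor

variable {A V : Type*} [CStarAlgebra A] [NormedAddCommGroup V] [InnerProductSpace ℂ V] {n : ℕ}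
  (R : PowerRepresentation A n V)

/-- The representation of the algebraic tensor power. -/
def lift : AlgPower A n →ₐ[ℂ] Module.End ℂ V :=
  PiTensorProduct.liftAlgHom (R := ℂ) (A := fun _ : Fin n => A) R.map R.map_one R.map_mul

lemma lift_tmul (a : Fin n → A) : R.lift (AlgPower.tmul a) = R.map a :=
  PiTensorProduct.lift.tprod a

lemma inner_lift_left (x : AlgPower A n) (v w : V) :
    inner ℂ (R.lift x v) w = inner ℂ v (R.lift (star x) w) := by
  induction x using AlgPower.induction with
  | h c a =>
    rw [AlgPower.star_smul_tmul, map_smul, map_smul, R.lift_tmul, R.lift_tmul,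
      LinearMap.smul_apply, LinearMap.smul_apply, inner_smul_left, inner_smul_right, R.inner_left]
    rfl
  | hadd x y hx hy =>
    rw [star_add, map_add, map_add, LinearMap.add_apply, LinearMap.add_apply, inner_add_left,
      inner_add_right, hx, hy]

/-- An elementary tensor is a product of tensors with one nontrivial entry, and each position
carries a representation of `A`, which is contractive. -/
lemma exists_bound (x : AlgPower A n) : ∃ C, ∀ v, ‖R.lift x v‖ ≤ C * ‖v‖ := by
  induction x using AlgPower.induction with
  | h c a =>
    have key : ∀ s : Finset (Fin n), ∃ C, ∀ v,
        ‖R.lift (AlgPower.tmul (fun i => if i ∈ s then a i else 1)) v‖ ≤ C * ‖v‖ := by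
      intro s
      induction s using Finset.induction_on with
      | empty =>
        refine ⟨1, fun v => ?_⟩
        have : (AlgPower.tmul (fun i => if i ∈ (∅ : Finset (Fin n)) then a i else 1)
          : AlgPower A n) = 1 := by simp; rfl
        rw [this, _root_.map_one, one_mul]
        rfl
      | insert j s hj ih =>
        obtain ⟨C, hC⟩ := ih
        have e : (AlgPower.tmul (fun i => if i ∈ insert j s then a i else 1) : AlgPower A n)
            = AlgPower.single j (a j) * AlgPower.tmul (fun i => if i ∈ s then a i else 1) := by
          change _ = AlgPower.tmul (Pi.mulSingle j (a j)) * _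
          rw [AlgPower.tmul_mul_tmul]
          congr 1
          funext i
          by_cases h : i = j
          · subst h; simp [hj]
          · simp [h]
        refine ⟨‖a j‖ * C, fun v => ?_⟩
        rw [e, _root_.map_mul, mul_assoc]
        refine (CStarAlgebra.norm_representation_le
          (R.lift.comp (AlgPower.single j : A →⋆ₐ[ℂ] AlgPower A n).toAlgHom)
          (fun b v w => ?_) (a j) _).trans (mul_le_mul_of_nonneg_left (hC v) (norm_nonneg _))
        change inner ℂ (R.lift (AlgPower.single j b) v) w
          = inner ℂ v (R.lift (AlgPower.single j (star b)) w)
        rw [map_star, R.inner_lift_left]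
    obtain ⟨C, hC⟩ := key Finset.univ
    refine ⟨‖c‖ * C, fun v => ?_⟩
    rw [map_smul, LinearMap.smul_apply, norm_smul, mul_assoc]
    exact mul_le_mul_of_nonneg_left (by simpa using hC v) (norm_nonneg _)
  | hadd x y hx hy =>
    obtain ⟨C, hC⟩ := hx
    obtain ⟨C', hC'⟩ := hy
    refine ⟨C + C', fun v => ?_⟩
    rw [map_add, LinearMap.add_apply, add_mul]
    exact (norm_add_le _ _).trans (add_le_add (hC v) (hC' v))

/-- The representation of the algebraic tensor power by bounded operators. -/
def toCLM (x : AlgPower A n) : V →L[ℂ] V :=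
  (R.lift x).mkContinuousOfExistsBound (R.exists_bound x)

lemma toCLM_apply (x : AlgPower A n) (v : V) : R.toCLM x v = R.lift x v := rfl

/-- Without completeness of `V` there is no adjoint operation on bounded operators to quote, so the
C⋆-identity is derived from `‖x v‖² = ⟨v, x⋆ x v⟩` and Cauchy–Schwarz. -/
lemma isCStarSeminorm : IsCStarSeminorm fun x => ‖R.toCLM x‖ := by
  have hmul (x y : AlgPower A n) : ‖R.toCLM (x * y)‖ ≤ ‖R.toCLM x‖ * ‖R.toCLM y‖ := by
    have : R.toCLM (x * y) = R.toCLM x * R.toCLM y := by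
      ext v
      change R.lift (x * y) v = R.lift x (R.lift y v)
      rw [_root_.map_mul]
      rfl
    rw [this]
    exact norm_mul_le _ _
  have hsq (x : AlgPower A n) : ‖R.toCLM x‖ ^ 2 ≤ ‖R.toCLM (star x * x)‖ := by
    have : ‖R.toCLM x‖ ≤ √‖R.toCLM (star x * x)‖ := by
      refine ContinuousLinearMap.opNorm_le_bound _ (Real.sqrt_nonneg _) fun v => ?_
      rw [← Real.sqrt_sq (norm_nonneg v), ← Real.sqrt_mul (norm_nonneg _)]
      apply Real.le_sqrt_of_sq_le
      have h1 : ‖R.toCLM x v‖ ^ 2 = ‖(inner ℂ v (R.toCLM (star x * x) v) : ℂ)‖ := by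
        rw [toCLM_apply, toCLM_apply, _root_.map_mul, Module.End.mul_apply, ← R.inner_lift_left,
          inner_self_eq_norm_sq_to_K, norm_pow]
        simp
      rw [h1]
      refine (norm_inner_le_norm _ _).trans ?_
      have := (R.toCLM (star x * x)).le_opNorm v
      nlinarith [norm_nonneg v]
    calc ‖R.toCLM x‖ ^ 2 ≤ √‖R.toCLM (star x * x)‖ ^ 2 := pow_le_pow_left₀ (norm_nonneg _) this 2
      _ = _ := Real.sq_sqrt (norm_nonneg _)
  -- Cancel `‖x‖` in `‖x‖² ≤ ‖x⋆ x‖ ≤ ‖x⋆‖ ‖x‖`.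
  have hstar (x : AlgPower A n) : ‖R.toCLM x‖ ≤ ‖R.toCLM (star x)‖ := by
    have h := (hsq x).trans (hmul _ _)
    rcases (norm_nonneg (R.toCLM x)).eq_or_lt with h0 | h0
    · rw [← h0]; exact norm_nonneg _
    · nlinarith
  refine ⟨fun x => norm_nonneg _, fun x y => ?_, fun c x => ?_, hmul,
    fun x => le_antisymm ((hmul _ _).trans ?_) (hsq x)⟩
  · have : R.toCLM (x + y) = R.toCLM x + R.toCLM y := by
      ext v
      change R.lift (x + y) v = R.lift x v + R.lift y v
      rw [map_add]
      rfl
    rw [this]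
    exact norm_add_le _ _
  · have : R.toCLM (c • x) = c • R.toCLM x := by
      ext v
      change R.lift (c • x) v = c • R.lift x v
      rw [map_smul]
      rfl
    rw [this, norm_smul]
  · have := hstar (star x)
    rw [star_star] at this
    rw [sq]
    exact mul_le_mul_of_nonneg_right this (norm_nonneg _)

end PowerRepresentation

/-! ### Nontriviality of the tensor power and the embedding -/

/-- The maximal tensor powers of a nontrivial C⋆-algebra are nontrivial. -/
instance CStarTensor.Power.instNontrivial {D : Type*} [CStarAlgebra D] [Nontrivial D] {n : ℕ} :
    Nontrivial (CStarTensor.Power D n) := by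
  obtain ⟨V, _, _, _, ⟨R⟩⟩ := PowerRepresentation.exists_nontrivial D n
  -- The maximal norm dominates the seminorm of the representation, which is `1` at the unit.
  have h1 : 1 ≤ ‖(1 : CStarTensor.AlgPower D n)‖ := by
    have h := CStarTensor.AlgPower.le_maxNorm R.isCStarSeminorm 1
    have e : R.toCLM 1 = 1 := by
      ext v
      rw [R.toCLM_apply, map_one]
      rfl
    rwa [e, norm_one] at h
  refine ⟨1, 0, fun h => ?_⟩
  have h2 : ‖(1 : CStarTensor.Power D n)‖ = ‖(1 : CStarTensor.AlgPower D n)‖ :=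
    UniformSpace.Completion.norm_coe (1 : CStarTensor.AlgPower D n)
  rw [h, norm_zero] at h2
  linarith

theorem corollary3p2 {D : Type*} [CStarAlgebra D] (P : UHF.Presentation D)
    (hP : P.IsInfiniteType) (p : ℕ) [Fact p.Prime] (hp : P.supernatural p ≠ 0)
    (n : ℕ) (hn : 0 < n) :
    ∃ φ : UHF.mInfty p →⋆ₐ[ℂ] CStarTensor.Power.symFixed D n, Function.Injective φ := by
  obtain ⟨N, c, hc_perm, hc_add⟩ := exists_symmetric_coloring p hn
  obtain ⟨u, hu, hcomm⟩ := P.exists_commuting_sequence (hP p Fact.out hp) N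
  have : Nontrivial D := P.nontrivial
  exact UHF.exists_mInfty_hom_of_mem CStarTensor.Power.isClosed_symFixed
    (fun i => CStarTensor.Power.isMatrixUnits_symUnits hc_add (hu i))
    (fun i i' h => CStarTensor.Power.commute_symUnits (hcomm i i' h))
    fun i => CStarTensor.Power.symUnits_mem hc_perm

end
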